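/- **Setting.** Let $R$ be a commutative ring with $m$ commuting derivations $\partial_1,\dots,\partial_m$ and with an action of a group $\Gamma$ by ring automorphisms $\hat g$ commuting with the $\partial_l$ (for trivial $\Gamma$ this is the purely differential case). All operators are differential-difference operators, i.e. finite sums $\sum a_{g,\sigma}\,\hat g\,\partial^\sigma$ and their bilinear analogues, and $(a\,\hat g\,\partial^\sigma)^\dagger=(-\partial)^\sigma \hat g^{-1}a$. In an extension $S\supseteq R$ of such rings, $a\sim b$ means $a-b\in\sum_l \mathrm{Im}\,\partial_l+\sum_{g}\mathrm{Im}(\hat g-1)$, and $\langle a,b\rangle=a^tb$ for vectors. Let $\mathcal G=R^N$ be a Lie algebra over $R$: its bracket is given by bilinear operators with coefficients in $R$, and it is skew and satisfies the Jacobi identity over every extension $S$ of $R$. Let $(X,v)\mapsto X.v$ be a representation of $\mathcal G$ on $V=R^M$ given by bilinear operators (again over every extension). Put $\mathcal G^*=R^N$, $V^*=R^M$, and define, over every extension, $$\langle X^{\cdot}u,Y\rangle\sim-\langle u,[X,Y]\rangle,\qquad \langle X^{\cdot}w,v\rangle\sim-\langle w,X.v\rangle,\qquad \langle v\nabla w,X\rangle\sim\langle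 w,X.v\rangle$$ by taking formal adjoints ($X,Y\in\mathcal G$, $u\in\mathcal G^*$, $v\in V$, $w\in V^*$). Let $\mathcal O:\mathcal G^*\to\mathcal G$ be an $\mathcal O$-operator: a linear operator which over every extension is skewsymmetric, $\langle u,\mathcal O(v)\rangle\sim-\langle v,\mathcal O(u)\rangle$, and satisfies $\mathcal O(\mathcal O(u)^{\cdot}v-\mathcal O(v)^{\cdot}u)=[\mathcal O(u),\mathcal O(v)]$. The commutator on $\mathcal G^*$ is $[u,v]=\mathcal O(u)^{\cdot}v-\mathcal O(v)^{\cdot}u$. Let $C=\mathrm{Fun}(V\oplus V^*)=R[x_\alpha^{(g|\sigma)},p_\alpha^{(g|\sigma)}]$ ($1\le\alpha\le M$, $g\in\Gamma$, $\sigma\in\mathbb Z_+^m$), where $x_\alpha^{(g|\sigma)}=\hat g\,\partial^\sigma x_\alpha$ and similarly for $p$, and let $\delta/\delta\mathbf x$, $\delta/\delta\mathbf p$ be the variational derivatives. For $X\in\mathcal G$ let $X^\wedge$ be the evolution derivation of $C$ (the derivation over $R$ commuting with all $\partial_l$ and $\hat g$) with $$X^\wedge(\mathbf x)=X.\mathbf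 x,\qquad X^\wedge(\mathbf p)=X^{\cdot}\mathbf p .$$ Let $B$ be the operator on $C^{M}\oplus C^{M}$ given by $B(K,L)=(W.\mathbf x,\;W^{\cdot}\mathbf p)$, $W=-\mathcal O(\mathbf x\nabla K-L\nabla\mathbf p)$, with blocks $B_{xx},B_{xp},B_{px},B_{pp}$. The quadratic bracket on $C$ is $\{H,F\}=X_H(F)$, where $X_H$ is the evolution derivation with $X_H(\mathbf x,\mathbf p)=B(\delta H/\delta\mathbf x,\delta H/\delta\mathbf p)$. For $H\in C$, let $H^\sim\in C\otimes\mathcal G^*=C^N$ be defined by $\langle H^\sim,X\rangle\sim X^\wedge(H)$ for all $X$ with entries in arbitrary extensions $S$ of $R$ (the relation being taken in $S[x_\alpha^{(g|\sigma)},p_\alpha^{(g|\sigma)}]$). **Proposition 9.27.** 1. For all $K,L\in C^M$, $$L^tB_{xx}(K)\sim\langle\mathbf x\nabla K,\mathcal O(\mathbf x\nabla L)\rangle,\qquad L^tB_{xp}(K)\sim-\langle K\nabla\mathbf p,\mathcal O(\mathbf x\nabla L)\rangle,$$ $$L^tB_{px}(K)\sim-\langle\mathbf x\nabla K,\mathcal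 O(L\nabla\mathbf p)\rangle,\qquad L^tB_{pp}(K)\sim\langle K\nabla\mathbf p,\mathcal O(L\nabla\mathbf p)\rangle,$$ so that $\{\,,\}$ is the quadratic bracket (8.6). 2. $X\mapsto X^\wedge$ is an antiaction: $[X,Y]^\wedge=Y^\wedge X^\wedge-X^\wedge Y^\wedge$ for all $X,Y\in\mathcal G$. 3. For every $H\in C$ the element $H^\sim$ exists and is unique. 4. The infinitesimal Hamiltonian action criterion (5.34) holds: for all $H,F\in C$ and all $X\in\mathcal G$, $$X^\wedge(\{H,F\})-\{X^\wedge(H),F\}-\{H,X^\wedge(F)\}\sim\langle[H^\sim,F^\sim],X\rangle .$$ -/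

import Mathlib

open MvPolynomial

universe u v

noncomputable section

/-! ### Differential-difference rings -/

/-- A commutative ring with `m` commuting derivations and with an action of a discrete group `Γ`
by ring automorphisms that commute with the derivations.
For trivial `Γ` this is a differential ring. -/
class DDRing (Γ : Type v) [Group Γ] (m : ℕ) (R : Type u) [CommRing R] where
  der : Fin m → Derivation ℤ R R
  shift : Γ →* RingAut R
  der_comm : ∀ i j a, der i (der j a) = der j (der i a)
  der_shift : ∀ i g a, der i (shift g a) = shift g (der i a)

/-- `S ⊇ R` is an extension of differential-difference rings. -/
class DDExtension (Γ : Type v) [Group Γ] (m : ℕ) (R : Type u) (S : Type*) [CommRing R] [CommRing S]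
    [Algebra R S] [DDRing Γ m R] [DDRing Γ m S] : Prop where
  injective : Function.Injective (algebraMap R S)
  der_algebraMap : ∀ (i : Fin m) (a : R),
    DDRing.der Γ i (algebraMap R S a) = algebraMap R S (DDRing.der Γ i a)
  shift_algebraMap : ∀ (g : Γ) (a : R),
    DDRing.shift m g (algebraMap R S a) = algebraMap R S (DDRing.shift m g a)

section Operators

variable (Γ : Type v) [Group Γ] (m : ℕ)

/-- `∂^σ = ∂₁^σ₁ ⋯ ∂ₘ^σₘ`. -/
def dpow {S : Type*} [CommRing S] [DDRing Γ m S] (σ : Fin m → ℕ) (f : S) : S :=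
  ((List.finRange m).map fun i =>
    ((DDRing.der Γ i : Derivation ℤ S S) : Module.End ℤ S) ^ σ i).prod f

/-- The subgroup `∑ Im ∂ₗ + ∑ Im (ĝ - 1)`. -/
def divergences (S : Type*) [CommRing S] [DDRing Γ m S] : AddSubgroup S :=
  AddSubgroup.closure
    ({a | ∃ (l : Fin m) (b : S), a = DDRing.der Γ l b} ∪
      {a | ∃ (g : Γ) (b : S), a = DDRing.shift m g b - b})

/-- `a ∼ b`: equality modulo `∑ Im ∂ₗ + ∑ Im (ĝ - 1)`. -/
def DDEquiv {S : Type*} [CommRing S] [DDRing Γ m S] (a b : S) : Prop :=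
  a - b ∈ divergences Γ m S

/-- Linear differential-difference operators `∑ a_{g,σ} ĝ ∂^σ` with coefficients in `R`. -/
abbrev DDOp (R : Type*) [CommRing R] := (Γ × (Fin m → ℕ)) →₀ R

/-- Bilinear differential-difference operators
`(f, h) ↦ ∑ a_{(g,σ),(g',τ)} (ĝ ∂^σ f) (ĝ' ∂^τ h)` with coefficients in `R`. -/
abbrev DDBiOp (R : Type*) [CommRing R] := ((Γ × (Fin m → ℕ)) × (Γ × (Fin m → ℕ))) →₀ R

variable {Γ m}

/-- `ĝ ∂^σ`. -/
def jet {S : Type*} [CommRing S] [DDRing Γ m S] (j : Γ × (Fin m → ℕ)) (f : S) : S :=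
  DDRing.shift m j.1 (dpow Γ m j.2 f)

/-- Application of an operator over `R` to an element of an `R`-algebra `S`. -/
def DDOp.apply {R S : Type*} [CommRing R] [CommRing S] [Algebra R S] [DDRing Γ m S]
    (L : DDOp Γ m R) (f : S) : S :=
  L.sum fun j a => algebraMap R S a * jet j f

/-- The formal adjoint `L†`, where `(a ĝ ∂^σ)† = (-∂)^σ ĝ⁻¹ a`. -/
def DDOp.adj {S : Type*} [CommRing S] [DDRing Γ m S] (L : DDOp Γ m S) (f : S) : S :=
  L.sum fun j a => (-1) ^ (∑ i, j.2 i) * dpow Γ m j.2 (DDRing.shift m j.1⁻¹ (a * f))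

/-- The linear operator `h ↦ B (f, h)`. -/
def DDBiOp.left {R S : Type*} [CommRing R] [CommRing S] [Algebra R S] [DDRing Γ m S]
    (B : DDBiOp Γ m R) (f : S) : DDOp Γ m S :=
  B.sum fun j a => Finsupp.single j.2 (algebraMap R S a * jet j.1 f)

/-- The linear operator `f ↦ B (f, h)`. -/
def DDBiOp.right {R S : Type*} [CommRing R] [CommRing S] [Algebra R S] [DDRing Γ m S]
    (B : DDBiOp Γ m R) (h : S) : DDOp Γ m S :=
  B.sum fun j a => Finsupp.single j.1 (algebraMap R S a * jet j.2 h)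

/-- `B (f, h)`. -/
def DDBiOp.apply {R S : Type*} [CommRing R] [CommRing S] [Algebra R S] [DDRing Γ m S]
    (B : DDBiOp Γ m R) (f h : S) : S :=
  B.sum fun j a => algebraMap R S a * (jet j.1 f * jet j.2 h)

/-- The pairing `⟨a, b⟩ = aᵗ b`. -/
def pairing {n : ℕ} {S : Type*} [CommRing S] (a b : Fin n → S) : S := ∑ i, a i * b i

end Operators

/-! ### Lie algebras, representations and `𝒪`-operators -/

/-- A differential-difference Lie algebra structure on `R^N`: the bracket is given by bilinear
differential-difference operators, and it is skew and satisfies the Jacobi identity over every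
extension of `R`. -/
structure DDLieAlgebra (Γ : Type v) [Group Γ] (m : ℕ) (R : Type u) [CommRing R] [DDRing Γ m R]
    (N : ℕ) where
  /-- `coeff i j k` is the contribution of the `i`-th and `j`-th entries to the `k`-th one. -/
  coeff : Fin N → Fin N → Fin N → DDBiOp Γ m R
  skew : ∀ (S : Type (max u v)) [CommRing S] [Algebra R S] [DDRing Γ m S] [DDExtension Γ m R S]
    (X Y : Fin N → S) (k : Fin N),
    (∑ i, ∑ j, (coeff i j k).apply (X i) (Y j)) = - ∑ i, ∑ j, (coeff i j k).apply (Y i) (X j)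
  jacobi : ∀ (S : Type (max u v)) [CommRing S] [Algebra R S] [DDRing Γ m S] [DDExtension Γ m R S]
    (X Y Z : Fin N → S),
    let br : (Fin N → S) → (Fin N → S) → (Fin N → S) :=
      fun X Y k => ∑ i, ∑ j, (coeff i j k).apply (X i) (Y j)
    br (br X Y) Z + br (br Y Z) X + br (br Z X) Y = 0

namespace DDLieAlgebra

variable {Γ : Type v} [Group Γ] {m : ℕ} {R : Type u} [CommRing R] [DDRing Γ m R] {N : ℕ}
  (𝔤 : DDLieAlgebra Γ m R N)

/-- The bracket `[X, Y]`. -/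
def bracket {S : Type*} [CommRing S] [Algebra R S] [DDRing Γ m S] (X Y : Fin N → S) : Fin N → S :=
  fun k => ∑ i, ∑ j, (𝔤.coeff i j k).apply (X i) (Y j)

/-- The coadjoint action `X˙u`, i.e. `⟨X˙u, Y⟩ ∼ -⟨u, [X, Y]⟩` for all `Y`. -/
def coad {S : Type*} [CommRing S] [Algebra R S] [DDRing Γ m S] (X u : Fin N → S) : Fin N → S :=
  fun j => - ∑ i, ∑ k, ((𝔤.coeff i j k).left (X i)).adj (u k)

/-- A representation of `𝔤` on `V = R^M` by differential-difference operators. -/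
structure Rep (M : ℕ) where
  /-- `coeff i α β` is the contribution of the `i`-th entry of `X` and the `α`-th entry of `v`
  to the `β`-th entry of `X.v`. -/
  coeff : Fin N → Fin M → Fin M → DDBiOp Γ m R
  map_bracket : ∀ (S : Type (max u v)) [CommRing S] [Algebra R S] [DDRing Γ m S]
    [DDExtension Γ m R S] (X Y : Fin N → S) (w : Fin M → S),
    let act : (Fin N → S) → (Fin M → S) → (Fin M → S) :=
      fun X w β => ∑ i, ∑ α, (coeff i α β).apply (X i) (w α)
    act (𝔤.bracket X Y) w = act X (act Y w) - act Y (act X w)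

/-- A (skewsymmetric) `𝒪`-operator `𝔤* → 𝔤`. -/
structure OOperator where
  coeff : Fin N → Fin N → DDOp Γ m R
  skew : ∀ (S : Type (max u v)) [CommRing S] [Algebra R S] [DDRing Γ m S] [DDExtension Γ m R S]
    (a b : Fin N → S),
    let O : (Fin N → S) → (Fin N → S) := fun a i => ∑ j, (coeff i j).apply (a j)
    DDEquiv Γ m (pairing a (O b)) (- pairing b (O a))
  hom : ∀ (S : Type (max u v)) [CommRing S] [Algebra R S] [DDRing Γ m S] [DDExtension Γ m R S]
    (a b : Fin N → S),
    let O : (Fin N → S) → (Fin N → S) := fun a i => ∑ j, (coeff i j).apply (a j)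
    O (𝔤.coad (O a) b - 𝔤.coad (O b) a) = 𝔤.bracket (O a) (O b)

variable {𝔤}

namespace OOperator

/-- `𝒪 (a)`. -/
def apply (O : 𝔤.OOperator) {S : Type*} [CommRing S] [Algebra R S] [DDRing Γ m S]
    (a : Fin N → S) : Fin N → S :=
  fun i => ∑ j, (O.coeff i j).apply (a j)

/-- The commutator on `𝔤*` induced by `𝒪`: `[a, b] = 𝒪(a)˙b - 𝒪(b)˙a`. -/
def dualBracket (O : 𝔤.OOperator) {S : Type*} [CommRing S] [Algebra R S] [DDRing Γ m S]
    (a b : Fin N → S) : Fin N → S :=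
  𝔤.coad (O.apply a) b - 𝔤.coad (O.apply b) a

end OOperator

namespace Rep

variable {M : ℕ} (V : 𝔤.Rep M) {S : Type*} [CommRing S] [Algebra R S] [DDRing Γ m S]

/-- The action `X.w` on `V`. -/
def act (X : Fin N → S) (w : Fin M → S) : Fin M → S :=
  fun β => ∑ i, ∑ α, (V.coeff i α β).apply (X i) (w α)

/-- The dual action `X˙w` on `V*`, i.e. `⟨X˙w, y⟩ ∼ -⟨w, X.y⟩` for all `y`. -/
def dualAct (X : Fin N → S) (w : Fin M → S) : Fin M → S :=
  fun α => - ∑ i, ∑ β, ((V.coeff i α β).left (X i)).adj (w β)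

/-- `∇ : V × V* → 𝔤*`, i.e. `⟨y ∇ w, X⟩ ∼ ⟨w, X.y⟩` for all `X`. -/
def nabla (y w : Fin M → S) : Fin N → S :=
  fun i => ∑ α, ∑ β, ((V.coeff i α β).right (y α)).adj (w β)

end Rep

end DDLieAlgebra

/-! ### Differential-difference polynomials -/

/-- The coefficientwise extension of a derivation of `R` to polynomials over `R`. -/
def coeffDerivation {R : Type*} [CommRing R] (I : Type*) (d : Derivation ℤ R R) :
    Derivation ℤ (MvPolynomial I R) (MvPolynomial I R) :=
  have key : ∀ (p : MvPolynomial I R) (s : I →₀ ℕ),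
      coeff s (∑ t ∈ p.support, monomial t (d (coeff t p))) = d (coeff s p) := by
    classical
    intro p s
    simp only [coeff_sum, coeff_monomial, Finset.sum_ite_eq', mem_support_iff]
    split_ifs with h
    · rfl
    · rw [not_not.mp h, map_zero]
  Derivation.mk'
    (AddMonoidHom.toIntLinearMap
      { toFun := fun p => ∑ t ∈ p.support, monomial t (d (coeff t p))
        map_zero' := by simp
        map_add' := fun p q => by ext s; rw [coeff_add, key, key, key, coeff_add, map_add] })
    (fun p q => by
      classical
      ext s
      change coeff s (∑ t ∈ (p * q).support, monomial t (d (coeff t (p * q)))) =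
        coeff s (p * (∑ t ∈ q.support, monomial t (d (coeff t q))) +
          q * (∑ t ∈ p.support, monomial t (d (coeff t p))))
      rw [key, coeff_add, mul_comm q, coeff_mul, coeff_mul, coeff_mul, map_sum,
        ← Finset.sum_add_distrib]
      refine Finset.sum_congr rfl fun x _ => ?_
      rw [key, key, Derivation.leibniz, smul_eq_mul, smul_eq_mul, mul_comm (coeff x.2 q)])

theorem coeff_coeffDerivation {R : Type*} [CommRing R] {I : Type*} (d : Derivation ℤ R R)
    (p : MvPolynomial I R) (s : I →₀ ℕ) : coeff s (coeffDerivation I d p) = d (coeff s p) := by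
  classical
  change coeff s (∑ t ∈ p.support, monomial t (d (coeff t p))) = d (coeff s p)
  simp only [coeff_sum, coeff_monomial, Finset.sum_ite_eq', mem_support_iff]
  split_ifs with h
  · rfl
  · rw [not_not.mp h, map_zero]

theorem coeffDerivation_C {R : Type*} [CommRing R] {I : Type*} (d : Derivation ℤ R R) (a : R) :
    coeffDerivation I d (C a) = C (d a) := by
  classical
  ext s
  rw [coeff_coeffDerivation, coeff_C, coeff_C]
  split_ifs <;> simp

theorem coeffDerivation_X {R : Type*} [CommRing R] {I : Type*} (d : Derivation ℤ R R) (i : I) :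
    coeffDerivation I d (X i) = 0 := by
  classical
  ext s
  rw [coeff_coeffDerivation, coeff_X, coeff_zero]
  split_ifs <;> simp

/-- The ring `R[q_b^{(g|σ)}]`, `b ∈ β`, `g ∈ Γ`, `σ ∈ ℤ₊^m`. -/
abbrev DDPoly (Γ : Type v) (m : ℕ) (β : Type) (R : Type*) [CommRing R] :=
  MvPolynomial (β × Γ × (Fin m → ℕ)) R

section DDPoly

variable {Γ : Type v} [Group Γ] {m : ℕ} {β : Type} {R : Type*} [CommRing R] [DDRing Γ m R]

/-- `∂ₗ` on `R[q_b^{(g|σ)}]`: it extends `∂ₗ` on `R` and sends `q_b^{(g|σ)}` to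
`q_b^{(g|σ+1ₗ)}`. -/
def DDPoly.der (l : Fin m) : Derivation ℤ (DDPoly Γ m β R) (DDPoly Γ m β R) :=
  coeffDerivation _ (DDRing.der Γ l) +
    (mkDerivation R fun q : β × Γ × (Fin m → ℕ) =>
      (X (q.1, q.2.1, q.2.2 + Pi.single l 1) : DDPoly Γ m β R)).restrictScalars ℤ

/-- `ĝ` on `R[q_b^{(h|σ)}]`: it extends `ĝ` on `R` and sends `q_b^{(h|σ)}` to `q_b^{(gh|σ)}`. -/
def DDPoly.shiftHom (g : Γ) : DDPoly Γ m β R →+* DDPoly Γ m β R :=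
  eval₂Hom (C.comp (DDRing.shift m g : RingAut R).toRingHom)
    fun q => X (q.1, g * q.2.1, q.2.2)

theorem DDPoly.der_C (l : Fin m) (a : R) :
    DDPoly.der l (C a : DDPoly Γ m β R) = C (DDRing.der Γ l a) := by
  simp [DDPoly.der, coeffDerivation_C]

theorem DDPoly.der_X (l : Fin m) (q : β × Γ × (Fin m → ℕ)) :
    DDPoly.der l (X q : DDPoly Γ m β R) = X (q.1, q.2.1, q.2.2 + Pi.single l 1) := by
  simp [DDPoly.der, coeffDerivation_X]

theorem DDPoly.shiftHom_C (g : Γ) (a : R) :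
    DDPoly.shiftHom g (C a : DDPoly Γ m β R) = C (DDRing.shift m g a) := by
  simp [DDPoly.shiftHom]

theorem DDPoly.shiftHom_X (g : Γ) (q : β × Γ × (Fin m → ℕ)) :
    DDPoly.shiftHom g (X q : DDPoly Γ m β R) = X (q.1, g * q.2.1, q.2.2) := by
  simp [DDPoly.shiftHom]

theorem DDPoly.shiftHom_one : (DDPoly.shiftHom 1 : DDPoly Γ m β R →+* _) = RingHom.id _ := by
  apply MvPolynomial.ringHom_ext <;> intros <;> simp [DDPoly.shiftHom_C, DDPoly.shiftHom_X]

theorem DDPoly.shiftHom_mul (g h : Γ) :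
    (DDPoly.shiftHom (g * h) : DDPoly Γ m β R →+* _) =
      (DDPoly.shiftHom g).comp (DDPoly.shiftHom h) := by
  apply MvPolynomial.ringHom_ext <;> intros <;>
    simp [DDPoly.shiftHom_C, DDPoly.shiftHom_X, mul_assoc]

/-- `ĝ` as an automorphism. -/
def DDPoly.shift : Γ →* RingAut (DDPoly Γ m β R) where
  toFun g := RingEquiv.ofRingHom (DDPoly.shiftHom g) (DDPoly.shiftHom g⁻¹)
    (by rw [← DDPoly.shiftHom_mul, mul_inv_cancel, DDPoly.shiftHom_one])
    (by rw [← DDPoly.shiftHom_mul, inv_mul_cancel, DDPoly.shiftHom_one])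
  map_one' := by
    ext1 p
    exact congrArg (fun f : DDPoly Γ m β R →+* DDPoly Γ m β R => f p) DDPoly.shiftHom_one
  map_mul' g h := by
    ext1 p
    exact congrArg (fun f : DDPoly Γ m β R →+* DDPoly Γ m β R => f p) (DDPoly.shiftHom_mul g h)

instance DDPoly.instDDRing : DDRing Γ m (DDPoly Γ m β R) where
  der := DDPoly.der
  shift := DDPoly.shift
  der_comm i j p := by
    change DDPoly.der i (DDPoly.der j p) = DDPoly.der j (DDPoly.der i p)
    induction p using MvPolynomial.induction_on with
    | C a => simp only [DDPoly.der_C, DDRing.der_comm i j a]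
    | add p q hp hq => simp only [map_add, hp, hq]
    | mul_X p q hp =>
      simp only [Derivation.leibniz, smul_eq_mul, map_add, DDPoly.der_X, hp,
        add_right_comm q.2.2 (Pi.single i 1) (Pi.single j 1)]
      ring
  der_shift i g p := by
    change DDPoly.der i (DDPoly.shiftHom g p) = DDPoly.shiftHom g (DDPoly.der i p)
    induction p using MvPolynomial.induction_on with
    | C a => simp only [DDPoly.der_C, DDPoly.shiftHom_C, DDRing.der_shift]
    | add p q hp hq => simp only [map_add, hp, hq]
    | mul_X p q hp =>
      simp only [Derivation.leibniz, smul_eq_mul, map_add, map_mul, DDPoly.der_X,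
        DDPoly.shiftHom_X, hp]

/-- The generators `q_b = q_b^{(1|0)}`. -/
def DDPoly.gen (b : β) : DDPoly Γ m β R := X (b, 1, 0)

/-- The evolution derivation over `R` with `q_b ↦ K_b`, i.e. `q_b^{(g|σ)} ↦ ĝ ∂^σ K_b`. -/
def DDPoly.evolution (K : β → DDPoly Γ m β R) : Derivation R (DDPoly Γ m β R) (DDPoly Γ m β R) :=
  mkDerivation R fun q => jet q.2 (K q.1)

/-- The Fréchet derivative `D_b(H) = ∑ (∂H/∂q_b^{(g|σ)}) ĝ ∂^σ`. -/
def DDPoly.frechet (b : β) (H : DDPoly Γ m β R) : DDOp Γ m (DDPoly Γ m β R) := by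
  classical
  exact Finsupp.onFinset (H.vars.image Prod.snd) (fun j => pderiv (b, j) H) fun j hj => by
    by_contra hn
    exact hj (pderiv_eq_zero_of_notMem_vars fun hv => hn (Finset.mem_image_of_mem Prod.snd hv))

/-- The variational derivative
`δH/δq_b = D_b(H)† (1) = ∑ (-∂)^σ ĝ⁻¹ (∂H/∂q_b^{(g|σ)})`. -/
def DDPoly.varDer (H : DDPoly Γ m β R) (b : β) : DDPoly Γ m β R := (DDPoly.frechet b H).adj 1

end DDPoly

/-! ### The quadratic bracket and the natural action on `Fun (V ⊕ V*)` -/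

/-- `Fun (V ⊕ V*) = R[x_α^{(g|σ)}, p_α^{(g|σ)}]`; `Sum.inl α` stands for `x_α` and `Sum.inr α`
for `p_α`. -/
abbrev FunVV (Γ : Type v) (m M : ℕ) (R : Type*) [CommRing R] := DDPoly Γ m (Fin M ⊕ Fin M) R

/-- The vector `𝐱`. -/
def xvec (Γ : Type v) [Group Γ] (m M : ℕ) (R : Type*) [CommRing R] [DDRing Γ m R] :
    Fin M → FunVV Γ m M R := fun α => DDPoly.gen (Sum.inl α)

/-- The vector `𝐩`. -/
def pvec (Γ : Type v) [Group Γ] (m M : ℕ) (R : Type*) [CommRing R] [DDRing Γ m R] :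
    Fin M → FunVV Γ m M R := fun α => DDPoly.gen (Sum.inr α)

namespace DDLieAlgebra.Rep

variable {Γ : Type v} [Group Γ] {m : ℕ} {R : Type u} [CommRing R] [DDRing Γ m R] {N M : ℕ}
  {𝔤 : DDLieAlgebra Γ m R N} (V : 𝔤.Rep M)

/-- The evolution derivation `X^∧` of `S[x^{(g|σ)}, p^{(g|σ)}]` with `X^∧(𝐱) = X.𝐱` and
`X^∧(𝐩) = X˙𝐩`, for `X` with entries in an extension `S` of `R`. -/
def hat {S : Type*} [CommRing S] [Algebra R S] [DDRing Γ m S] (X : Fin N → S) :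
    Derivation S (FunVV Γ m M S) (FunVV Γ m M S) :=
  DDPoly.evolution (Sum.elim
    (V.act (fun i => C (X i)) (xvec Γ m M S))
    (V.dualAct (fun i => C (X i)) (pvec Γ m M S)))

/-- `a ∈ Fun (V ⊕ V*) ⊗ 𝔤*` is the element `H^∼` determined by `⟨H^∼, X⟩ ∼ X^∧(H)` for all `X`
with entries in arbitrary extensions of `R`. -/
def IsTilde (H : FunVV Γ m M R) (a : Fin N → FunVV Γ m M R) : Prop :=
  ∀ (S : Type (max u v)) [CommRing S] [Algebra R S] [DDRing Γ m S] [DDExtension Γ m R S]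
    (X : Fin N → S),
    DDEquiv Γ m (pairing (fun i => MvPolynomial.map (algebraMap R S) (a i)) fun i => C (X i))
      (V.hat X (MvPolynomial.map (algebraMap R S) H))

/-- The quadratic Hamiltonian matrix `B` on `V ⊕ V*`, as an operator on pairs `(K, L)`:
`B(K, L) = (W.𝐱, W˙𝐩)` where `W = -𝒪(𝐱 ∇ K - L ∇ 𝐩)`. -/
def quadMatrix (O : 𝔤.OOperator) (Y : Fin M ⊕ Fin M → FunVV Γ m M R) :
    Fin M ⊕ Fin M → FunVV Γ m M R :=
  let x := xvec Γ m M R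
  let p := pvec Γ m M R
  let W := - O.apply (V.nabla x (fun α => Y (Sum.inl α)) - V.nabla (fun α => Y (Sum.inr α)) p)
  Sum.elim (V.act W x) (V.dualAct W p)

/-- The bracket `{H, F} = X_H(F)`, where `X_H` is the evolution derivation with
`X_H(𝐪) = B(δH/δ𝐪)`. -/
def quadBracket (O : 𝔤.OOperator) (H F : FunVV Γ m M R) : FunVV Γ m M R :=
  DDPoly.evolution (V.quadMatrix O (DDPoly.varDer H)) F

end DDLieAlgebra.Rep

end

/-! Everything runs through the momentum map J(H) = 𝐱 ∇ δH/δ𝐱 − δH/δ𝐩 ∇ 𝐩 (`momentum`). For W that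
may depend on 𝐱 and 𝐩, let W^∧ be the evolution derivation with velocities W.𝐱 and W˙𝐩 (`fieldHat`).
Integration by parts gives W^∧(F) ∼ ⟨J(F), W⟩ (`fieldHat_ddEquiv`). Constant W shows that J(F)
serves as F^∼, and W = −𝒪(J(H)) gives W^∧(F) = {H, F}.

Relations modulo divergences become equalities after pairing with a vector y of independent
variables, since δ/δy kills divergences and reads off coefficients (`eq_zero_of_pairing_gen`). This
yields the uniqueness of H^∼ and the fact that V* is a representation. The axioms apply to y, 𝐱 and
𝐩 because polynomial rings are themselves extensions (`instDDExtension`).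

On generators one checks [X^∧, W^∧] = (X^∧(W) + [W, X])^∧ for constant X
(`hat_fieldHat_commutator`); constant W gives the antiaction. Together with uniqueness it gives
J(X^∧ H) = X^∧(J(H)) − X˙J(H) (`momentum_hat`).

Put h = J(H), f = J(F). In the criterion the terms with 𝒪(X^∧ h) cancel, leaving −⟨f, [𝒪(h), X]⟩ −
⟨f, 𝒪(X˙h)⟩. Skewness of 𝒪 and the definition of the coadjoint action turn this into ⟨𝒪(h)˙f −
𝒪(f)˙h, X⟩. -/

set_option linter.unusedSectionVars false

noncomputable section

/-! ### Jets, their adjoints, and calculus modulo divergences. -/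

section Jets

variable {Γ : Type v} [Group Γ] {m : ℕ}
variable {S : Type*} [CommRing S] [DDRing Γ m S] {T : Type*} [CommRing T] [DDRing Γ m T]

/-- An additive map between differential-difference rings that commutes with the derivations and
with the group action. -/
structure IsDDHom (Γ : Type v) [Group Γ] (m : ℕ) {S T : Type*} [CommRing S] [DDRing Γ m S]
    [CommRing T] [DDRing Γ m T] (φ : S →+ T) : Prop where
  map_der : ∀ (l : Fin m) (a : S), φ (DDRing.der Γ l a) = DDRing.der Γ l (φ a)
  map_shift : ∀ (g : Γ) (a : S), φ (DDRing.shift m g a) = DDRing.shift m g (φ a)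

/-- `∂^σ` as an endomorphism. -/
def dpowEnd (Γ : Type v) [Group Γ] (m : ℕ) {S : Type*} [CommRing S] [DDRing Γ m S]
    (σ : Fin m → ℕ) : Module.End ℤ S :=
  ((List.finRange m).map fun i =>
    ((DDRing.der Γ i : Derivation ℤ S S) : Module.End ℤ S) ^ σ i).prod

theorem dpowEnd_apply (σ : Fin m → ℕ) (f : S) : dpowEnd Γ m σ f = dpow Γ m σ f := rfl

theorem map_dpow_of_map_der (φ : S →+ T)
    (h : ∀ (l : Fin m) (a : S), φ (DDRing.der Γ l a) = DDRing.der Γ l (φ a))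
    (σ : Fin m → ℕ) (f : S) : φ (dpow Γ m σ f) = dpow Γ m σ (φ f) := by
  have hpow : ∀ (i : Fin m) (n : ℕ) (a : S),
      φ ((((DDRing.der Γ i : Derivation ℤ S S) : Module.End ℤ S) ^ n) a) =
        (((DDRing.der Γ i : Derivation ℤ T T) : Module.End ℤ T) ^ n) (φ a) := by
    intro i n
    induction n with
    | zero => intro a; simp
    | succ n ih => intro a; rw [pow_succ, pow_succ, Module.End.mul_apply, Module.End.mul_apply, ih]
                   exact congrArg _ (h i a)
  unfold dpow
  induction List.finRange m with
  | nil => simp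
  | cons i l ih => simp only [List.map_cons, List.prod_cons, Module.End.mul_apply, hpow, ih]

theorem commute_der (i j : Fin m) :
    Commute ((DDRing.der Γ i : Derivation ℤ S S) : Module.End ℤ S)
      ((DDRing.der Γ j : Derivation ℤ S S) : Module.End ℤ S) := by
  ext a
  exact DDRing.der_comm i j a

theorem dpow_add_index (σ τ : Fin m → ℕ) (f : S) :
    dpow Γ m (σ + τ) f = dpow Γ m σ (dpow Γ m τ f) := by
  rw [← dpowEnd_apply, ← dpowEnd_apply, ← dpowEnd_apply, ← Module.End.mul_apply]
  congr 1
  unfold dpowEnd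
  induction List.finRange m with
  | nil => simp
  | cons i l ih =>
    simp only [List.map_cons, List.prod_cons, ih, mul_assoc]
    rw [Pi.add_apply, pow_add, mul_assoc]
    congr 1
    rw [← mul_assoc, ← mul_assoc]
    congr 1
    -- The power of `∂ᵢ` coming from τ must pass the σ-powers of the remaining derivations; this is
    -- where commutativity of the derivations enters.
    refine Commute.list_prod_right _ _ fun x hx => ?_
    obtain ⟨j, -, rfl⟩ := List.mem_map.mp hx
    exact (commute_der i j).pow_pow _ _

theorem dpow_zero_index (f : S) : dpow Γ m 0 f = f := by
  simp [dpow]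

theorem dpow_single (l : Fin m) (f : S) : dpow Γ m (Pi.single l 1) f = DDRing.der Γ l f := by
  -- Duplicate-freeness makes the exponent 1 count exactly once, and it is inherited by tails, so
  -- the induction can run over sublists of `List.finRange m`.
  have key : ∀ L : List (Fin m), L.Nodup → (L.map fun i =>
      ((DDRing.der Γ i : Derivation ℤ S S) : Module.End ℤ S) ^ (Pi.single l 1 : Fin m → ℕ) i).prod =
      if l ∈ L then ((DDRing.der Γ l : Derivation ℤ S S) : Module.End ℤ S) else 1 := by
    intro L hL
    induction L with
    | nil => simp
    | cons i L ih =>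
      rw [List.nodup_cons] at hL
      rw [List.map_cons, List.prod_cons, ih hL.2]
      by_cases h : l = i
      · subst h; simp [hL.1]
      · simp [h, Ne.symm h]
  unfold dpow
  rw [key _ (List.nodup_finRange m), if_pos (List.mem_finRange l)]
  rfl

@[simp] theorem dpow_add (σ : Fin m → ℕ) (f h : S) :
    dpow Γ m σ (f + h) = dpow Γ m σ f + dpow Γ m σ h := map_add (dpowEnd Γ m σ) f h

@[simp] theorem dpow_zero (σ : Fin m → ℕ) : dpow Γ m σ (0 : S) = 0 := map_zero (dpowEnd Γ m σ)

theorem dpow_der (σ : Fin m → ℕ) (l : Fin m) (f : S) :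
    dpow Γ m σ (DDRing.der Γ l f) = DDRing.der Γ l (dpow Γ m σ f) := by
  rw [← dpow_single, ← dpow_single, ← dpow_add_index, ← dpow_add_index, add_comm]

theorem shift_shift (g h : Γ) (f : S) :
    DDRing.shift m g (DDRing.shift m h f) = DDRing.shift m (g * h) f := by
  rw [map_mul]; rfl

theorem shift_one (f : S) : DDRing.shift m (1 : Γ) f = f := by
  rw [map_one]; rfl

@[simp] theorem jet_add (j : Γ × (Fin m → ℕ)) (f h : S) : jet j (f + h) = jet j f + jet j h := by
  simp [jet]

@[simp] theorem jet_zero (j : Γ × (Fin m → ℕ)) : jet j (0 : S) = 0 := by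
  simp [jet]

theorem jet_one_zero (f : S) : jet ((1, 0) : Γ × (Fin m → ℕ)) f = f := by
  simp only [jet, dpow_zero_index, shift_one]

theorem IsDDHom.map_dpow {φ : S →+ T} (h : IsDDHom Γ m φ) (σ : Fin m → ℕ) (f : S) :
    φ (dpow Γ m σ f) = dpow Γ m σ (φ f) := map_dpow_of_map_der φ h.map_der σ f

theorem IsDDHom.map_jet {φ : S →+ T} (h : IsDDHom Γ m φ) (j : Γ × (Fin m → ℕ)) (f : S) :
    φ (jet j f) = jet j (φ f) := by
  rw [jet, h.map_shift, h.map_dpow, jet]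

/-- The adjoint `a ↦ (-∂)^σ ĝ⁻¹ a` of `ĝ ∂^σ`. -/
def jetAdj (j : Γ × (Fin m → ℕ)) : S →+ S where
  toFun a := (-1) ^ (∑ i, j.2 i) * dpow Γ m j.2 (DDRing.shift m j.1⁻¹ a)
  map_zero' := by simp
  map_add' a b := by simp [mul_add]

theorem jetAdj_apply (j : Γ × (Fin m → ℕ)) (a : S) :
    jetAdj j a = (-1) ^ (∑ i, j.2 i) * dpow Γ m j.2 (DDRing.shift m j.1⁻¹ a) := rfl

theorem jetAdj_one_zero (f : S) : jetAdj ((1, 0) : Γ × (Fin m → ℕ)) f = f := by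
  simp [jetAdj_apply, dpow_zero_index]

/-- φ is only additive (it may be a derivation), so the sign is extracted by parity and not by
multiplicativity. -/
theorem IsDDHom.map_neg_one_pow_mul {φ : S →+ T} (n : ℕ) (a : S) :
    φ ((-1) ^ n * a) = (-1) ^ n * φ a := by
  rcases neg_one_pow_eq_or S n with h | h <;> rcases Nat.even_or_odd n with h' | h' <;>
    simp [h'.neg_one_pow]

theorem IsDDHom.map_jetAdj {φ : S →+ T} (h : IsDDHom Γ m φ) (j : Γ × (Fin m → ℕ)) (f : S) :
    φ (jetAdj j f) = jetAdj j (φ f) := by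
  rw [jetAdj_apply, jetAdj_apply, map_neg_one_pow_mul, h.map_dpow, h.map_shift]

/-- Adjoints reverse composition and `∂ₗ† = −∂ₗ`. With `jetAdj_shift`, this is the source of the
vanishing of variational derivatives on divergences. -/
theorem jetAdj_der (g : Γ) (σ : Fin m → ℕ) (l : Fin m) (a : S) :
    jetAdj (g, σ + Pi.single l 1) a = - jetAdj (g, σ) (DDRing.der Γ l a) := by
  have : ∑ i, (σ + Pi.single l 1 : Fin m → ℕ) i = (∑ i, σ i) + 1 := by
    simp [Finset.sum_add_distrib]
  simp only [jetAdj_apply, this, dpow_add_index, dpow_single, pow_succ, DDRing.der_shift]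
  ring

theorem jetAdj_shift (g h : Γ) (σ : Fin m → ℕ) (a : S) :
    jetAdj (h * g, σ) (DDRing.shift m h a) = jetAdj (g, σ) a := by
  simp only [jetAdj_apply, shift_shift]
  simp

/-! ### Divergences -/

theorem der_mem_divergences (l : Fin m) (a : S) : DDRing.der Γ l a ∈ divergences Γ m S :=
  AddSubgroup.subset_closure (Or.inl ⟨l, a, rfl⟩)

theorem shift_sub_mem_divergences (g : Γ) (a : S) :
    DDRing.shift m g a - a ∈ divergences Γ m S :=
  AddSubgroup.subset_closure (Or.inr ⟨g, a, rfl⟩)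

theorem map_eq_zero_of_mem_divergences {A : Type*} [AddGroup A] (φ : S →+ A)
    (hder : ∀ (l : Fin m) a, φ (DDRing.der Γ l a) = 0)
    (hshift : ∀ (g : Γ) a, φ (DDRing.shift m g a) = φ a) {a : S} (ha : a ∈ divergences Γ m S) :
    φ a = 0 := by
  have : divergences Γ m S ≤ φ.ker := by
    rw [divergences, AddSubgroup.closure_le]
    rintro x (⟨l, b, rfl⟩ | ⟨g, b, rfl⟩)
    · exact hder l b
    · change φ _ = 0
      rw [map_sub, hshift, sub_self]
  exact this ha

theorem IsDDHom.map_mem_divergences {φ : S →+ T} (h : IsDDHom Γ m φ) {a : S}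
    (ha : a ∈ divergences Γ m S) : φ a ∈ divergences Γ m T := by
  have : divergences Γ m S ≤ (divergences Γ m T).comap φ := by
    conv_lhs => rw [divergences]
    rw [AddSubgroup.closure_le]
    rintro x (⟨l, b, rfl⟩ | ⟨g, b, rfl⟩)
    · change φ _ ∈ divergences Γ m T
      rw [h.map_der]
      exact der_mem_divergences l _
    · change φ _ ∈ divergences Γ m T
      rw [map_sub, h.map_shift]
      exact shift_sub_mem_divergences g _
  exact this ha

namespace DDEquiv

theorem of_eq {a b : S} (h : a = b) : DDEquiv Γ m a b := by
  rw [DDEquiv, h, sub_self]; exact zero_mem _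

@[refl] theorem refl (a : S) : DDEquiv Γ m a a := of_eq rfl

@[symm] theorem symm {a b : S} (h : DDEquiv Γ m a b) : DDEquiv Γ m b a := by
  have := neg_mem h
  rwa [neg_sub] at this

@[trans] theorem trans {a b c : S} (h : DDEquiv Γ m a b) (h' : DDEquiv Γ m b c) :
    DDEquiv Γ m a c := by
  have := add_mem h h'
  rwa [sub_add_sub_cancel] at this

instance : Trans (DDEquiv Γ m (S := S)) (DDEquiv Γ m) (DDEquiv Γ m) := ⟨trans⟩

theorem add {a b c d : S} (h : DDEquiv Γ m a b) (h' : DDEquiv Γ m c d) :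
    DDEquiv Γ m (a + c) (b + d) := by
  have := add_mem h h'
  rwa [sub_add_sub_comm] at this

theorem neg {a b : S} (h : DDEquiv Γ m a b) : DDEquiv Γ m (-a) (-b) := by
  have := neg_mem h
  rw [DDEquiv]
  convert this using 1
  ring

theorem sub {a b c d : S} (h : DDEquiv Γ m a b) (h' : DDEquiv Γ m c d) :
    DDEquiv Γ m (a - c) (b - d) := by
  rw [sub_eq_add_neg, sub_eq_add_neg]
  exact h.add h'.neg

theorem sum {ι : Type*} (s : Finset ι) {f h : ι → S} (H : ∀ i ∈ s, DDEquiv Γ m (f i) (h i)) :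
    DDEquiv Γ m (∑ i ∈ s, f i) (∑ i ∈ s, h i) := by
  rw [DDEquiv, ← Finset.sum_sub_distrib]
  exact sum_mem H

end DDEquiv

theorem IsDDHom.map_ddEquiv {φ : S →+ T} (h : IsDDHom Γ m φ) {a b : S} (hab : DDEquiv Γ m a b) :
    DDEquiv Γ m (φ a) (φ b) := by
  rw [DDEquiv, ← map_sub]
  exact h.map_mem_divergences hab

theorem mul_der_ddEquiv (l : Fin m) (a b : S) :
    DDEquiv Γ m (a * DDRing.der Γ l b) (-(DDRing.der Γ l a * b)) := by
  have := der_mem_divergences (Γ := Γ) l (a * b)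
  rw [Derivation.leibniz, smul_eq_mul, smul_eq_mul] at this
  rw [DDEquiv]
  convert this using 1
  ring

theorem mul_shift_ddEquiv (g : Γ) (a b : S) :
    DDEquiv Γ m (a * DDRing.shift m g b) (DDRing.shift m g⁻¹ a * b) := by
  -- The difference of the two sides is ĝc − c for c = (ĝ⁻¹a)b.
  have := shift_sub_mem_divergences (m := m) g (DDRing.shift m g⁻¹ a * b)
  rw [map_mul, shift_shift, mul_inv_cancel, shift_one] at this
  exact this

theorem mul_dpow_ddEquiv (σ : Fin m → ℕ) (a b : S) :
    DDEquiv Γ m (a * dpow Γ m σ b) ((-1) ^ (∑ i, σ i) * dpow Γ m σ a * b) := by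
  induction h : ∑ i, σ i generalizing σ a with
  | zero =>
    have : σ = 0 := by
      ext i
      exact (Finset.sum_eq_zero_iff.mp h) i (Finset.mem_univ i)
    subst this
    simp only [dpow_zero_index]
    exact DDEquiv.of_eq (by ring)
  | succ n ih =>
    obtain ⟨l, hl⟩ : ∃ l, σ l ≠ 0 := by
      by_contra! hc
      simp [hc] at h
    obtain ⟨τ, rfl⟩ : ∃ τ : Fin m → ℕ, σ = (Pi.single l 1 : Fin m → ℕ) + τ := by
      -- The truncated subtraction is exact because `σ l ≠ 0`.
      refine ⟨σ - Pi.single l 1, funext fun i => ?_⟩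
      change σ i = (Pi.single l 1 : Fin m → ℕ) i + (σ i - (Pi.single l 1 : Fin m → ℕ) i)
      rcases eq_or_ne i l with rfl | hi
      · rw [Pi.single_eq_same]; omega
      · rw [Pi.single_eq_of_ne hi]; omega
    have hn : ∑ i, τ i = n := by
      simp [Finset.sum_add_distrib] at h
      omega
    rw [dpow_add_index, dpow_single]
    refine (mul_der_ddEquiv l _ _).trans ?_
    refine (ih τ (DDRing.der Γ l a) hn).neg.trans (DDEquiv.of_eq ?_)
    rw [dpow_der, dpow_add_index, dpow_single, pow_succ]
    ring

theorem mul_jet_ddEquiv (j : Γ × (Fin m → ℕ)) (a b : S) :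
    DDEquiv Γ m (a * jet j b) (jetAdj j a * b) :=
  (mul_shift_ddEquiv j.1 a _).trans (mul_dpow_ddEquiv j.2 _ b)

end Jets

/-! ### Linear and bilinear operators, their adjoints, and compatible maps. -/

section OperatorLemmas

variable {Γ : Type v} [Group Γ] {m : ℕ} {R : Type*} [CommRing R]
variable {S : Type*} [CommRing S] [Algebra R S] [DDRing Γ m S]
variable {T : Type*} [CommRing T] [Algebra R T] [DDRing Γ m T]

theorem IsDDHom.derivation_jet {D : Derivation R S S} (h : IsDDHom Γ m (D : S →+ S))
    (j : Γ × (Fin m → ℕ)) (a : S) : D (jet j a) = jet j (D a) := h.map_jet j a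

theorem IsDDHom.derivation_jetAdj {D : Derivation R S S} (h : IsDDHom Γ m (D : S →+ S))
    (j : Γ × (Fin m → ℕ)) (a : S) : D (jetAdj j a) = jetAdj j (D a) := h.map_jetAdj j a

theorem IsDDHom.algHom_jet {φ : S →ₐ[R] T} (h : IsDDHom Γ m (φ : S →+ T))
    (j : Γ × (Fin m → ℕ)) (a : S) : φ (jet j a) = jet j (φ a) := h.map_jet j a

theorem IsDDHom.algHom_jetAdj {φ : S →ₐ[R] T} (h : IsDDHom Γ m (φ : S →+ T))
    (j : Γ × (Fin m → ℕ)) (a : S) : φ (jetAdj j a) = jetAdj j (φ a) := h.map_jetAdj j a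

namespace DDOp

theorem adj_eq (L : DDOp Γ m S) (f : S) : L.adj f = L.sum fun j a => jetAdj j (a * f) := rfl

theorem apply_add (L : DDOp Γ m R) (f h : S) : L.apply (f + h) = L.apply f + L.apply h := by
  simp [DDOp.apply, mul_add, Finsupp.sum_add]

theorem apply_zero (L : DDOp Γ m R) : L.apply (0 : S) = 0 := by
  simp [DDOp.apply]

theorem adj_zero (L : DDOp Γ m S) : L.adj 0 = 0 := by
  simp [adj_eq]

theorem derivation_apply (L : DDOp Γ m R) {D : Derivation R S S}
    (hD : IsDDHom Γ m (D : S →+ S)) (f : S) : D (L.apply f) = L.apply (D f) := by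
  simp [DDOp.apply, Finsupp.sum, hD.derivation_jet]

/-- The defining property of the formal adjoint; the relations for X˙u, X˙w and ∇ all reduce to it.
-/
theorem mul_apply_ddEquiv (L : DDOp Γ m S) (w f : S) :
    DDEquiv Γ m (w * L.apply f) (L.adj w * f) := by
  rw [DDOp.apply, adj_eq, Finsupp.sum, Finsupp.sum, Finset.mul_sum, Finset.sum_mul]
  refine DDEquiv.sum _ fun j _ => ?_
  refine (DDEquiv.of_eq ?_).trans (mul_jet_ddEquiv j (L j * w) f)
  rw [Algebra.algebraMap_self_apply]
  ring

end DDOp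

namespace DDBiOp

variable (B : DDBiOp Γ m R)

theorem apply_add_left (f f' h : S) : B.apply (f + f') h = B.apply f h + B.apply f' h := by
  simp [DDBiOp.apply, mul_add, add_mul, Finsupp.sum_add]

theorem apply_zero_left (h : S) : B.apply 0 h = 0 := by
  simp [DDBiOp.apply]

theorem left_apply (f h : S) : (B.left f).apply h = B.apply f h := by
  rw [DDOp.apply, DDBiOp.left, Finsupp.sum_sum_index (by simp) (by simp [add_mul])]
  refine Finsupp.sum_congr fun j _ => ?_
  rw [Finsupp.sum_single_index (by simp), Algebra.algebraMap_self_apply, mul_assoc]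

theorem right_apply (f h : S) : (B.right h).apply f = B.apply f h := by
  rw [DDOp.apply, DDBiOp.right, Finsupp.sum_sum_index (by simp) (by simp [add_mul])]
  refine Finsupp.sum_congr fun j _ => ?_
  rw [Finsupp.sum_single_index (by simp), Algebra.algebraMap_self_apply]
  ring

theorem left_adj (f w : S) : (B.left f).adj w =
    B.sum fun j a => jetAdj j.2 (algebraMap R S a * jet j.1 f * w) := by
  rw [DDOp.adj_eq, DDBiOp.left, Finsupp.sum_sum_index (by simp) (by simp [add_mul])]
  refine Finsupp.sum_congr fun j _ => ?_
  rw [Finsupp.sum_single_index (by simp)]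

theorem right_adj (h w : S) : (B.right h).adj w =
    B.sum fun j a => jetAdj j.1 (algebraMap R S a * jet j.2 h * w) := by
  rw [DDOp.adj_eq, DDBiOp.right, Finsupp.sum_sum_index (by simp) (by simp [add_mul])]
  refine Finsupp.sum_congr fun j _ => ?_
  rw [Finsupp.sum_single_index (by simp)]

theorem mul_apply_ddEquiv_left (f h w : S) :
    DDEquiv Γ m (w * B.apply f h) ((B.left f).adj w * h) := by
  rw [← left_apply]
  exact DDOp.mul_apply_ddEquiv _ _ _

theorem mul_apply_ddEquiv_right (f h w : S) :
    DDEquiv Γ m (w * B.apply f h) ((B.right h).adj w * f) := by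
  rw [← right_apply]
  exact DDOp.mul_apply_ddEquiv _ _ _

theorem left_adj_add (f f' w : S) :
    (B.left (f + f')).adj w = (B.left f).adj w + (B.left f').adj w := by
  simp [left_adj, mul_add, add_mul, Finsupp.sum_add]

theorem right_adj_zero (w : S) : (B.right (0 : S)).adj w = 0 := by
  simp [right_adj]

theorem left_adj_zero (w : S) : (B.left (0 : S)).adj w = 0 := by
  simp [left_adj]

/-- D kills the coefficients in R and commutes with jets, so only the two arguments are
differentiated. -/
theorem derivation_apply {D : Derivation R S S} (hD : IsDDHom Γ m (D : S →+ S)) (f h : S) :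
    D (B.apply f h) = B.apply (D f) h + B.apply f (D h) := by
  simp only [DDBiOp.apply, Finsupp.sum, map_sum, ← Finset.sum_add_distrib]
  refine Finset.sum_congr rfl fun j _ => ?_
  simp only [Derivation.leibniz, Derivation.map_algebraMap, hD.derivation_jet, smul_eq_mul]
  ring

theorem derivation_left_adj {D : Derivation R S S} (hD : IsDDHom Γ m (D : S →+ S)) (f w : S) :
    D ((B.left f).adj w) = (B.left (D f)).adj w + (B.left f).adj (D w) := by
  simp only [left_adj, Finsupp.sum, map_sum, ← Finset.sum_add_distrib]
  refine Finset.sum_congr rfl fun j _ => ?_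
  rw [hD.derivation_jetAdj, ← map_add]
  congr 1
  simp only [Derivation.leibniz, Derivation.map_algebraMap, hD.derivation_jet, smul_eq_mul]
  ring

theorem algHom_apply {φ : S →ₐ[R] T} (hφ : IsDDHom Γ m (φ : S →+ T)) (f h : S) :
    φ (B.apply f h) = B.apply (φ f) (φ h) := by
  simp [DDBiOp.apply, Finsupp.sum, hφ.algHom_jet]

theorem algHom_left_adj {φ : S →ₐ[R] T} (hφ : IsDDHom Γ m (φ : S →+ T)) (f w : S) :
    φ ((B.left f).adj w) = (B.left (φ f)).adj (φ w) := by
  simp [left_adj, Finsupp.sum, hφ.algHom_jet, hφ.algHom_jetAdj]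

theorem algHom_right_adj {φ : S →ₐ[R] T} (hφ : IsDDHom Γ m (φ : S →+ T)) (f w : S) :
    φ ((B.right f).adj w) = (B.right (φ f)).adj (φ w) := by
  simp [right_adj, Finsupp.sum, hφ.algHom_jet, hφ.algHom_jetAdj]

end DDBiOp

end OperatorLemmas

/-! ### Bilinearity of the pairing. -/

section Pairing

variable {n : ℕ} {S : Type*} [CommRing S]

theorem pairing_comm (a b : Fin n → S) : pairing a b = pairing b a := by
  simp [pairing, mul_comm]

theorem pairing_add (a b c : Fin n → S) : pairing a (b + c) = pairing a b + pairing a c := by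
  simp [pairing, mul_add, Finset.sum_add_distrib]

theorem pairing_neg (a b : Fin n → S) : pairing a (-b) = - pairing a b := by
  simp [pairing]

theorem pairing_sub (a b c : Fin n → S) : pairing a (b - c) = pairing a b - pairing a c := by
  simp [sub_eq_add_neg, pairing_add, pairing_neg]

theorem neg_pairing (a b : Fin n → S) : pairing (-a) b = - pairing a b := by
  simp [pairing]

theorem sub_pairing (a b c : Fin n → S) : pairing (a - b) c = pairing a c - pairing b c := by
  simp [pairing_comm _ c, pairing_sub]

end Pairing

/-! ### Adjunction relations and naturality for the bracket, 𝒪, the actions and ∇. -/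

namespace DDLieAlgebra

variable {Γ : Type v} [Group Γ] {m : ℕ} {R : Type u} [CommRing R] [DDRing Γ m R] {N : ℕ}
  (𝔤 : DDLieAlgebra Γ m R N)
variable {S : Type*} [CommRing S] [Algebra R S] [DDRing Γ m S]
variable {T : Type*} [CommRing T] [Algebra R T] [DDRing Γ m T]

theorem bracket_skew {S : Type (max u v)} [CommRing S] [Algebra R S] [DDRing Γ m S]
    [DDExtension Γ m R S] (X Y : Fin N → S) : 𝔤.bracket X Y = - 𝔤.bracket Y X :=
  funext fun k => 𝔤.skew S X Y k

theorem pairing_bracket (X Y u : Fin N → S) :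
    DDEquiv Γ m (pairing u (𝔤.bracket X Y)) (- pairing (𝔤.coad X u) Y) := by
  have : - pairing (𝔤.coad X u) Y =
      ∑ k, ∑ i, ∑ j, ((𝔤.coeff i j k).left (X i)).adj (u k) * Y j := by
    simp only [pairing, coad, neg_mul, Finset.sum_neg_distrib, neg_neg, Finset.sum_mul]
    exact Finset.sum_comm.trans
      ((Finset.sum_congr rfl fun _ _ => Finset.sum_comm).trans Finset.sum_comm)
  rw [this]
  simp only [pairing, bracket, Finset.mul_sum]
  exact DDEquiv.sum _ fun k _ => DDEquiv.sum _ fun i _ => DDEquiv.sum _ fun j _ =>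
    DDBiOp.mul_apply_ddEquiv_left _ _ _ _

theorem algHom_bracket {φ : S →ₐ[R] T} (hφ : IsDDHom Γ m (φ : S →+ T)) (X Y : Fin N → S)
    (k : Fin N) : φ (𝔤.bracket X Y k) = 𝔤.bracket (fun i => φ (X i)) (fun i => φ (Y i)) k := by
  simp [bracket, DDBiOp.algHom_apply _ hφ]

theorem algHom_coad {φ : S →ₐ[R] T} (hφ : IsDDHom Γ m (φ : S →+ T)) (X w : Fin N → S)
    (k : Fin N) : φ (𝔤.coad X w k) = 𝔤.coad (fun i => φ (X i)) (fun i => φ (w i)) k := by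
  simp [coad, DDBiOp.algHom_left_adj _ hφ]

variable {𝔤}

namespace OOperator

variable (O : 𝔤.OOperator)

theorem apply_add (a b : Fin N → S) : O.apply (a + b) = O.apply a + O.apply b := by
  ext i
  simp [apply, DDOp.apply_add, Finset.sum_add_distrib]

theorem apply_zero : O.apply (0 : Fin N → S) = 0 := by
  ext i
  simp [apply, DDOp.apply_zero]

theorem apply_neg (a : Fin N → S) : O.apply (-a) = - O.apply a := by
  rw [eq_neg_iff_add_eq_zero, ← apply_add, neg_add_cancel, apply_zero]

theorem apply_sub (a b : Fin N → S) : O.apply (a - b) = O.apply a - O.apply b := by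
  rw [sub_eq_add_neg, apply_add, apply_neg, sub_eq_add_neg]

theorem pairing_apply {S : Type (max u v)} [CommRing S] [Algebra R S] [DDRing Γ m S]
    [DDExtension Γ m R S] (a b : Fin N → S) :
    DDEquiv Γ m (pairing a (O.apply b)) (- pairing b (O.apply a)) := O.skew S a b

theorem derivation_apply {D : Derivation R S S} (hD : IsDDHom Γ m (D : S →+ S))
    (a : Fin N → S) (i : Fin N) : D (O.apply a i) = O.apply (fun j => D (a j)) i := by
  simp [apply, DDOp.derivation_apply _ hD]

end OOperator

namespace Rep

variable {M : ℕ} (V : 𝔤.Rep M)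

theorem act_bracket {S : Type (max u v)} [CommRing S] [Algebra R S] [DDRing Γ m S]
    [DDExtension Γ m R S] (X Y : Fin N → S) (w : Fin M → S) :
    V.act (𝔤.bracket X Y) w = V.act X (V.act Y w) - V.act Y (V.act X w) :=
  V.map_bracket S X Y w

theorem add_act (X X' : Fin N → S) (w : Fin M → S) :
    V.act (X + X') w = V.act X w + V.act X' w := by
  ext; simp [act, DDBiOp.apply_add_left, Finset.sum_add_distrib]

theorem zero_act (w : Fin M → S) : V.act (0 : Fin N → S) w = 0 := by
  ext; simp [act, DDBiOp.apply_zero_left]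

theorem zero_dualAct (w : Fin M → S) : V.dualAct (0 : Fin N → S) w = 0 := by
  ext; simp [dualAct, DDBiOp.left_adj_zero]

theorem add_dualAct (X X' : Fin N → S) (w : Fin M → S) :
    V.dualAct (X + X') w = V.dualAct X w + V.dualAct X' w := by
  ext; simp [dualAct, DDBiOp.left_adj_add, Finset.sum_add_distrib, add_comm]

theorem nabla_zero (y : Fin M → S) : V.nabla y 0 = 0 := by
  ext; simp [nabla, DDOp.adj_zero]

theorem zero_nabla (w : Fin M → S) : V.nabla 0 w = 0 := by
  ext; simp [nabla, DDBiOp.right_adj_zero]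

theorem pairing_act (X : Fin N → S) (y w : Fin M → S) :
    DDEquiv Γ m (pairing w (V.act X y)) (- pairing (V.dualAct X w) y) := by
  have : - pairing (V.dualAct X w) y =
      ∑ β, ∑ i, ∑ α, ((V.coeff i α β).left (X i)).adj (w β) * y α := by
    simp only [pairing, dualAct, neg_mul, Finset.sum_neg_distrib, neg_neg, Finset.sum_mul]
    exact Finset.sum_comm.trans
      ((Finset.sum_congr rfl fun _ _ => Finset.sum_comm).trans Finset.sum_comm)
  rw [this]
  simp only [pairing, act, Finset.mul_sum]
  exact DDEquiv.sum _ fun k _ => DDEquiv.sum _ fun i _ => DDEquiv.sum _ fun j _ =>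
    DDBiOp.mul_apply_ddEquiv_left _ _ _ _

theorem pairing_act_nabla (X : Fin N → S) (y w : Fin M → S) :
    DDEquiv Γ m (pairing w (V.act X y)) (pairing (V.nabla y w) X) := by
  have : pairing (V.nabla y w) X =
      ∑ β, ∑ i, ∑ α, ((V.coeff i α β).right (y α)).adj (w β) * X i := by
    simp only [pairing, nabla, Finset.sum_mul]
    rw [Finset.sum_comm_cycle]
  rw [this]
  simp only [pairing, act, Finset.mul_sum]
  exact DDEquiv.sum _ fun k _ => DDEquiv.sum _ fun i _ => DDEquiv.sum _ fun j _ =>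
    DDBiOp.mul_apply_ddEquiv_right _ _ _ _

/-- Both sides are adjoint forms of −⟨w, X.y⟩. The sign here is the origin of the minus in 𝐱 ∇ K − L
∇ 𝐩. -/
theorem pairing_dualAct_nabla (X : Fin N → S) (y w : Fin M → S) :
    DDEquiv Γ m (pairing y (V.dualAct X w)) (- pairing (V.nabla y w) X) := by
  rw [pairing_comm, ← neg_neg (pairing (V.dualAct X w) y)]
  exact ((V.pairing_act X y w).symm.trans (V.pairing_act_nabla X y w)).neg

theorem derivation_act {D : Derivation R S S} (hD : IsDDHom Γ m (D : S →+ S)) (X : Fin N → S)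
    (w : Fin M → S) (β : Fin M) :
    D (V.act X w β) = V.act (fun i => D (X i)) w β + V.act X (fun α => D (w α)) β := by
  simp [act, DDBiOp.derivation_apply _ hD, Finset.sum_add_distrib]

theorem derivation_dualAct {D : Derivation R S S} (hD : IsDDHom Γ m (D : S →+ S))
    (X : Fin N → S) (w : Fin M → S) (β : Fin M) :
    D (V.dualAct X w β) =
      V.dualAct (fun i => D (X i)) w β + V.dualAct X (fun α => D (w α)) β := by
  simp [dualAct, DDBiOp.derivation_left_adj _ hD, Finset.sum_add_distrib, add_comm]

theorem algHom_act {φ : S →ₐ[R] T} (hφ : IsDDHom Γ m (φ : S →+ T)) (X : Fin N → S)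
    (w : Fin M → S) (k : Fin M) :
    φ (V.act X w k) = V.act (fun i => φ (X i)) (fun i => φ (w i)) k := by
  simp [act, DDBiOp.algHom_apply _ hφ]

theorem algHom_dualAct {φ : S →ₐ[R] T} (hφ : IsDDHom Γ m (φ : S →+ T)) (X : Fin N → S)
    (w : Fin M → S) (k : Fin M) :
    φ (V.dualAct X w k) = V.dualAct (fun i => φ (X i)) (fun i => φ (w i)) k := by
  simp [dualAct, DDBiOp.algHom_left_adj _ hφ]

theorem algHom_nabla {φ : S →ₐ[R] T} (hφ : IsDDHom Γ m (φ : S →+ T)) (y w : Fin M → S)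
    (k : Fin N) :
    φ (V.nabla y w k) = V.nabla (fun i => φ (y i)) (fun i => φ (w i)) k := by
  simp [nabla, DDBiOp.algHom_right_adj _ hφ]

end Rep

end DDLieAlgebra

/-! ### Differential-difference polynomials. -/

namespace DDPoly

variable {Γ : Type v} [Group Γ] {m : ℕ} {β : Type} {S : Type*} [CommRing S] [DDRing Γ m S]

theorem ddDer_C (l : Fin m) (a : S) :
    DDRing.der Γ l (C a : DDPoly Γ m β S) = C (DDRing.der Γ l a) := der_C l a

theorem ddDer_X (l : Fin m) (b : β) (g : Γ) (σ : Fin m → ℕ) :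
    DDRing.der Γ l (X (b, g, σ) : DDPoly Γ m β S) = X (b, g, σ + Pi.single l 1) := der_X l _

theorem ddShift_C (g : Γ) (a : S) :
    DDRing.shift m g (C a : DDPoly Γ m β S) = C (DDRing.shift m g a) := shiftHom_C g a

theorem ddShift_X (h : Γ) (b : β) (g : Γ) (σ : Fin m → ℕ) :
    DDRing.shift m h (X (b, g, σ) : DDPoly Γ m β S) = X (b, h * g, σ) := shiftHom_X h _

theorem jet_gen (b : β) (j : Γ × (Fin m → ℕ)) :
    jet j (gen b : DDPoly Γ m β S) = X (b, j) := by
  have hpow : ∀ (i : Fin m) (n : ℕ) (σ : Fin m → ℕ),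
      (((DDRing.der Γ i : Derivation ℤ (DDPoly Γ m β S) (DDPoly Γ m β S)) :
        Module.End ℤ (DDPoly Γ m β S)) ^ n) (X (b, 1, σ)) = X (b, 1, σ + Pi.single i n) := by
    intro i n
    induction n with
    | zero => intro σ; simp
    | succ n ih =>
      intro σ
      rw [pow_succ, Module.End.mul_apply]
      refine (congrArg _ (ddDer_X i b 1 σ)).trans ?_
      rw [ih, add_assoc, ← Pi.single_add, add_comm 1 n]
  -- Each factor `∂ᵢ^σᵢ` adds σᵢ to the i-th exponent; over the full list these increments sum to σ.
  have hL : ∀ L : List (Fin m), (L.map fun i =>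
      ((DDRing.der Γ i : Derivation ℤ (DDPoly Γ m β S) (DDPoly Γ m β S)) :
        Module.End ℤ (DDPoly Γ m β S)) ^ j.2 i).prod (X (b, 1, 0)) =
      X (b, 1, (L.map fun i => (Pi.single i (j.2 i) : Fin m → ℕ)).sum) := by
    intro L
    induction L with
    | nil => simp
    | cons i L ih =>
      rw [List.map_cons, List.prod_cons, Module.End.mul_apply, ih, hpow, List.map_cons,
        List.sum_cons, add_comm]
  have hsum : ((List.finRange m).map fun i => (Pi.single i (j.2 i) : Fin m → ℕ)).sum = j.2 := by
    rw [← List.ofFn_eq_map, List.sum_ofFn, Finset.univ_sum_single]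
  rw [jet, dpow, gen, hL, hsum, ddShift_X, mul_one]

/-! ### Homomorphisms out of differential-difference polynomials -/

/-- Both compositions with `∂ₗ` are derivations along φ, and both with ĝ are ring homomorphisms, so
agreement on coefficients and variables suffices. -/
theorem isDDHom_of_gen {T : Type*} [CommRing T] [DDRing Γ m T] (φ : DDPoly Γ m β S →+* T)
    (hC : IsDDHom Γ m ((φ.comp C : S →+* T) : S →+ T))
    (hX : ∀ b j, φ (X (b, j)) = jet j (φ (gen b))) : IsDDHom Γ m (φ : DDPoly Γ m β S →+ T) where
  map_der l a := by
    change φ (DDRing.der Γ l a) = DDRing.der Γ l (φ a)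
    induction a using MvPolynomial.induction_on with
    | C a => rw [ddDer_C]; exact hC.map_der l a
    | add p q hp hq => simp only [map_add, hp, hq]
    | mul_X p q hp =>
      obtain ⟨b, g, σ⟩ := q
      simp only [Derivation.leibniz, smul_eq_mul, map_add, map_mul, ddDer_X, hp, hX]
      congr 2
      simp only [jet]
      rw [DDRing.der_shift, ← dpow_single, ← dpow_add_index, add_comm]
  map_shift h a := by
    change φ (DDRing.shift m h a) = DDRing.shift m h (φ a)
    induction a using MvPolynomial.induction_on with
    | C a => rw [ddShift_C]; exact hC.map_shift h a
    | add p q hp hq => simp only [map_add, hp, hq]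
    | mul_X p q hp =>
      obtain ⟨b, g, σ⟩ := q
      simp only [map_mul, ddShift_X, hp, hX]
      congr 1
      simp only [jet]
      rw [shift_shift]

theorem isDDHom_C : IsDDHom Γ m ((C : S →+* DDPoly Γ m β S) : S →+ DDPoly Γ m β S) where
  map_der l a := (ddDer_C l a).symm
  map_shift g a := (ddShift_C g a).symm

theorem isDDHom_map {T : Type*} [CommRing T] [DDRing Γ m T] (φ : S →+* T)
    (hφ : IsDDHom Γ m (φ : S →+ T)) :
    IsDDHom Γ m ((MvPolynomial.map φ : DDPoly Γ m β S →+* DDPoly Γ m β T) :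
      DDPoly Γ m β S →+ DDPoly Γ m β T) := by
  refine isDDHom_of_gen _ ⟨fun l a => ?_, fun g a => ?_⟩ fun b j => ?_
  · change MvPolynomial.map φ (C _) = DDRing.der Γ l (MvPolynomial.map φ (C a))
    rw [map_C, map_C, ddDer_C]
    exact congrArg C (hφ.map_der l a)
  · change MvPolynomial.map φ (C _) = DDRing.shift m g (MvPolynomial.map φ (C a))
    rw [map_C, map_C, ddShift_C]
    exact congrArg C (hφ.map_shift g a)
  · rw [gen, map_X, map_X]
    exact (jet_gen b j).symm

/-- This lets identities assumed over every extension be used for vectors depending on 𝐱 and 𝐩, and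
for vectors of independent variables. -/
instance instDDExtension {R : Type*} [CommRing R] [DDRing Γ m R] [Algebra R S]
    [DDExtension Γ m R S] : DDExtension Γ m R (DDPoly Γ m β S) where
  injective := by
    rw [IsScalarTower.algebraMap_eq R S (DDPoly Γ m β S), RingHom.coe_comp]
    exact (C_injective _ _).comp (DDExtension.injective Γ m)
  der_algebraMap i a := by
    simp only [MvPolynomial.algebraMap_apply, ddDer_C, DDExtension.der_algebraMap]
  shift_algebraMap i a := by
    simp only [MvPolynomial.algebraMap_apply, ddShift_C, DDExtension.shift_algebraMap]

/-! ### Evolution derivations -/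

theorem evolution_X (K : β → DDPoly Γ m β S) (b : β) (j : Γ × (Fin m → ℕ)) :
    evolution K (X (b, j)) = jet j (K b) := by
  rw [evolution, mkDerivation_X]

theorem evolution_gen (K : β → DDPoly Γ m β S) (b : β) : evolution K (gen b) = K b := by
  rw [gen, evolution_X, jet_one_zero]

theorem evolution_C (K : β → DDPoly Γ m β S) (a : S) : evolution K (C a) = 0 :=
  (evolution K).map_algebraMap a

theorem isDDHom_evolution (K : β → DDPoly Γ m β S) :
    IsDDHom Γ m (evolution K : DDPoly Γ m β S →+ DDPoly Γ m β S) where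
  map_der l a := by
    change evolution K (DDRing.der Γ l a) = DDRing.der Γ l (evolution K a)
    induction a using MvPolynomial.induction_on with
    | C a => simp only [ddDer_C, evolution_C, map_zero]
    | add p q hp hq => simp only [map_add, hp, hq]
    | mul_X p q hp =>
      obtain ⟨b, g, σ⟩ := q
      have : jet (g, σ + Pi.single l 1) (K b) = DDRing.der Γ l (jet (g, σ) (K b)) := by
        simp only [jet]
        rw [DDRing.der_shift, ← dpow_single, ← dpow_add_index, add_comm]
      simp only [Derivation.leibniz, smul_eq_mul, map_add, ddDer_X, hp, evolution_X, this]
      ring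
  map_shift h a := by
    change evolution K (DDRing.shift m h a) = DDRing.shift m h (evolution K a)
    induction a using MvPolynomial.induction_on with
    | C a => simp only [ddShift_C, evolution_C, map_zero]
    | add p q hp hq => simp only [map_add, hp, hq]
    | mul_X p q hp =>
      obtain ⟨b, g, σ⟩ := q
      have : jet (h * g, σ) (K b) = DDRing.shift m h (jet (g, σ) (K b)) := by
        simp only [jet]
        rw [shift_shift]
      simp only [Derivation.leibniz, smul_eq_mul, map_add, map_mul, ddShift_X, hp, evolution_X,
        this]

theorem evolution_jet (K : β → DDPoly Γ m β S) (j : Γ × (Fin m → ℕ)) (a : DDPoly Γ m β S) :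
    evolution K (jet j a) = jet j (evolution K a) := (isDDHom_evolution K).map_jet j a

/-- The commutator of two evolution derivations is the evolution derivation of its values on the
generators. -/
theorem evolution_commutator (K L P : β → DDPoly Γ m β S)
    (h : ∀ b, evolution K (L b) - evolution L (K b) = P b) (H : DDPoly Γ m β S) :
    evolution K (evolution L H) - evolution L (evolution K H) = evolution P H := by
  have : ⁅evolution K, evolution L⁆ = evolution P := by
    refine MvPolynomial.derivation_ext fun q => ?_
    obtain ⟨b, j⟩ := q
    rw [Derivation.commutator_apply, evolution_X, evolution_X, evolution_X, evolution_jet,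
      evolution_jet, ← h, sub_eq_iff_eq_add, ← jet_add, sub_add_cancel]
  rw [← this, Derivation.commutator_apply]

theorem map_evolution {T : Type*} [CommRing T] [DDRing Γ m T] (φ : S →+* T)
    (hφ : IsDDHom Γ m (φ : S →+ T)) (K : β → DDPoly Γ m β S) (H : DDPoly Γ m β S) :
    MvPolynomial.map φ (evolution K H) =
      evolution (fun b => MvPolynomial.map φ (K b)) (MvPolynomial.map φ H) := by
  induction H using MvPolynomial.induction_on with
  | C a => simp only [evolution_C, map_C, map_zero]
  | add p q hp hq => simp only [map_add, hp, hq]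
  | mul_X p q hp =>
    obtain ⟨b, j⟩ := q
    have := (isDDHom_map (β := β) φ hφ).map_jet j (K b)
    simp only [Derivation.leibniz, smul_eq_mul, map_add, map_mul, evolution_X, hp, map_X]
    congr 2

/-! ### Variational derivatives -/

theorem frechet_apply (b : β) (H : DDPoly Γ m β S) (j : Γ × (Fin m → ℕ)) :
    frechet b H j = pderiv (b, j) H := rfl

open Classical in
/-- The Fréchet derivative as a derivation with values in operators. -/
def frechetDer (b : β) : Derivation S (DDPoly Γ m β S) (DDOp Γ m (DDPoly Γ m β S)) :=
  mkDerivation S fun q => if q.1 = b then Finsupp.single q.2 1 else 0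

open Classical in
theorem frechetDer_X (b c : β) (j : Γ × (Fin m → ℕ)) :
    frechetDer b (X (c, j) : DDPoly Γ m β S) = if c = b then Finsupp.single j 1 else 0 := by
  rw [frechetDer, mkDerivation_X]

/-- For each fixed jet index both sides are derivations in H, hence determined by the variables. -/
theorem frechet_eq (b : β) (H : DDPoly Γ m β S) : frechet b H = frechetDer b H := by
  classical
  ext1 j
  rw [frechet_apply]
  have : pderiv (b, j) = (Finsupp.lapply (R := DDPoly Γ m β S) j).compDer
      (frechetDer (Γ := Γ) (m := m) (S := S) b) := by
    refine MvPolynomial.derivation_ext fun q => ?_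
    obtain ⟨c, k⟩ := q
    change _ = frechetDer b (X (c, k)) j
    rw [frechetDer_X, pderiv_X]
    by_cases hc : c = b <;> by_cases hk : k = j <;>
      simp [hc, hk]
  rw [this]
  rfl

/-- Integration by parts: `X_K (H) ∼ ∑ K_b δH/δq_b`. -/
theorem evolution_ddEquiv [Fintype β] (K : β → DDPoly Γ m β S) (H : DDPoly Γ m β S) :
    DDEquiv Γ m (evolution K H) (∑ b, varDer H b * K b) := by
  classical
  have hsum (D : β → Derivation S (DDPoly Γ m β S) (DDPoly Γ m β S)) (a : DDPoly Γ m β S) :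
      (∑ b, D b) a = ∑ b, D b a :=
    (congrFun (map_sum Derivation.coeFnAddMonoidHom D Finset.univ) a).trans
      (Finset.sum_apply _ _ _)
  -- The chain rule X_K(H) = ∑ D_b(H)(K_b), as an identity of derivations tested on variables.
  -- Moving D_b(H) onto the factor 1 then produces δH/δq_b.
  have key : evolution K = ∑ b, (Finsupp.linearCombination (DDPoly Γ m β S)
      fun j : Γ × (Fin m → ℕ) => jet j (K b)).compDer (frechetDer b) := by
    refine MvPolynomial.derivation_ext fun q => ?_
    obtain ⟨c, j⟩ := q
    rw [evolution_X, hsum]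
    change _ = ∑ b, Finsupp.linearCombination (DDPoly Γ m β S)
      (fun j : Γ × (Fin m → ℕ) => jet j (K b)) (frechetDer b (X (c, j)))
    simp only [frechetDer_X]
    rw [Finset.sum_eq_single c (fun b _ hb => by rw [if_neg hb.symm, map_zero]) (by simp)]
    simp
  have : evolution K H = ∑ b, 1 * (frechet b H).apply (K b) := by
    rw [key, hsum]
    refine Finset.sum_congr rfl fun b _ => ?_
    rw [frechet_eq, one_mul]
    rfl
  rw [this]
  exact DDEquiv.sum _ fun b _ => DDOp.mul_apply_ddEquiv _ _ _

/-- `L ↦ L† (1)` as an additive map. -/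
def adjOne {T : Type*} [CommRing T] [DDRing Γ m T] : DDOp Γ m T →+ T :=
  Finsupp.liftAddHom fun j => jetAdj j

theorem adj_one_eq {T : Type*} [CommRing T] [DDRing Γ m T] (L : DDOp Γ m T) :
    L.adj 1 = adjOne L := by
  rw [DDOp.adj_eq, adjOne, Finsupp.liftAddHom_apply]
  simp only [mul_one]

theorem adjOne_single {T : Type*} [CommRing T] [DDRing Γ m T] (j : Γ × (Fin m → ℕ)) (a : T) :
    adjOne (Finsupp.single j a) = jetAdj j a := by
  rw [adjOne, Finsupp.liftAddHom_apply_single]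

theorem varDer_eq (H : DDPoly Γ m β S) (b : β) : varDer H b = adjOne (frechetDer b H) := by
  rw [varDer, adj_one_eq, frechet_eq]

theorem varDer_add (H F : DDPoly Γ m β S) (b : β) :
    varDer (H + F) b = varDer H b + varDer F b := by
  simp only [varDer_eq, map_add]

theorem varDer_zero (b : β) : varDer (0 : DDPoly Γ m β S) b = 0 := by
  simp only [varDer_eq, map_zero]

/-- Left composition of an operator with `∂ₗ`. -/
def derComp (l : Fin m) {T : Type*} [CommRing T] [DDRing Γ m T] : DDOp Γ m T →+ DDOp Γ m T :=
  Finsupp.liftAddHom fun j => (Finsupp.singleAddHom j).comp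
      ((DDRing.der Γ l : Derivation ℤ T T) : T →+ T) +
    Finsupp.singleAddHom (j.1, j.2 + Pi.single l 1)

theorem derComp_single (l : Fin m) {T : Type*} [CommRing T] [DDRing Γ m T]
    (j : Γ × (Fin m → ℕ)) (a : T) : derComp l (Finsupp.single j a) =
      Finsupp.single j (DDRing.der Γ l a) + Finsupp.single (j.1, j.2 + Pi.single l 1) a := by
  rw [derComp, Finsupp.liftAddHom_apply_single]
  rfl

theorem derComp_smul (l : Fin m) {T : Type*} [CommRing T] [DDRing Γ m T] (c : T)
    (L : DDOp Γ m T) : derComp l (c • L) = c • derComp l L + DDRing.der Γ l c • L := by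
  induction L using Finsupp.induction_linear with
  | zero => simp
  | add f g hf hg => simp only [smul_add, map_add, hf, hg]; abel
  | single j a =>
    simp only [Finsupp.smul_single, smul_eq_mul, derComp_single, Derivation.leibniz, smul_add,
      Finsupp.single_add, mul_comm a]
    abel

/-- Left composition of an operator with `ĥ`. -/
def shiftComp (h : Γ) {T : Type*} [CommRing T] [DDRing Γ m T] : DDOp Γ m T →+ DDOp Γ m T :=
  Finsupp.liftAddHom fun j => (Finsupp.singleAddHom (h * j.1, j.2)).comp
      ((DDRing.shift m h : RingAut T) : T →+ T)

theorem shiftComp_single (h : Γ) {T : Type*} [CommRing T] [DDRing Γ m T]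
    (j : Γ × (Fin m → ℕ)) (a : T) : shiftComp h (Finsupp.single j a) =
      Finsupp.single (h * j.1, j.2) (DDRing.shift m h a) := by
  rw [shiftComp, Finsupp.liftAddHom_apply_single]
  rfl

theorem shiftComp_smul (h : Γ) {T : Type*} [CommRing T] [DDRing Γ m T] (c : T)
    (L : DDOp Γ m T) : shiftComp h (c • L) = DDRing.shift m h c • shiftComp h L := by
  induction L using Finsupp.induction_linear with
  | zero => simp
  | add f g hf hg => simp only [smul_add, map_add, hf, hg]
  | single j a => simp only [Finsupp.smul_single, smul_eq_mul, shiftComp_single, map_mul]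

theorem frechetDer_C (b : β) (a : S) : frechetDer b (C a : DDPoly Γ m β S) = 0 :=
  (frechetDer b).map_algebraMap a

/-- Linearisation intertwines `∂ₗ` on polynomials with left composition by `∂ₗ` on operators. -/
theorem frechetDer_der (b : β) (l : Fin m) (H : DDPoly Γ m β S) :
    frechetDer b (DDRing.der Γ l H) = derComp l (frechetDer b H) := by
  induction H using MvPolynomial.induction_on with
  | C a => simp only [ddDer_C, frechetDer_C, map_zero]
  | add p q hp hq => simp only [map_add, hp, hq]
  | mul_X p q hp =>
    obtain ⟨c, g, σ⟩ := q
    have : derComp l (frechetDer b (X (c, g, σ) : DDPoly Γ m β S)) =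
        frechetDer b (X (c, g, σ + Pi.single l 1)) := by
      rw [frechetDer_X, frechetDer_X]
      split_ifs
      · rw [derComp_single, Derivation.map_one_eq_zero, Finsupp.single_zero, zero_add]
      · rw [map_zero]
    simp only [Derivation.leibniz, smul_eq_mul, map_add, ddDer_X, hp, derComp_smul, this]
    abel

theorem frechetDer_shift (b : β) (h : Γ) (H : DDPoly Γ m β S) :
    frechetDer b (DDRing.shift m h H) = shiftComp h (frechetDer b H) := by
  induction H using MvPolynomial.induction_on with
  | C a => simp only [ddShift_C, frechetDer_C, map_zero]
  | add p q hp hq => simp only [map_add, hp, hq]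
  | mul_X p q hp =>
    obtain ⟨c, g, σ⟩ := q
    have : shiftComp h (frechetDer b (X (c, g, σ) : DDPoly Γ m β S)) =
        frechetDer b (X (c, h * g, σ)) := by
      rw [frechetDer_X, frechetDer_X]
      split_ifs
      · rw [shiftComp_single, map_one]
      · rw [map_zero]
    simp only [Derivation.leibniz, map_mul, map_add, ddShift_X, hp, shiftComp_smul, this]

/-- (∂ₗL)†(1) = L†(−∂ₗ1) = 0. -/
theorem adjOne_derComp (l : Fin m) {T : Type*} [CommRing T] [DDRing Γ m T] (L : DDOp Γ m T) :
    adjOne (derComp l L) = 0 := by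
  induction L using Finsupp.induction_linear with
  | zero => simp only [map_zero]
  | add f g hf hg => rw [map_add, map_add, hf, hg, add_zero]
  | single j a =>
    rw [derComp_single, map_add, adjOne_single, adjOne_single, jetAdj_der, add_neg_cancel]

/-- (ĥL)†(1) = L†(ĥ⁻¹1) = L†(1). -/
theorem adjOne_shiftComp (h : Γ) {T : Type*} [CommRing T] [DDRing Γ m T] (L : DDOp Γ m T) :
    adjOne (shiftComp h L) = adjOne L := by
  induction L using Finsupp.induction_linear with
  | zero => simp only [map_zero]
  | add f g hf hg => rw [map_add, map_add, map_add, hf, hg]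
  | single j a => rw [shiftComp_single, adjOne_single, adjOne_single, jetAdj_shift]

/-- Variational derivatives annihilate divergences. -/
theorem varDer_eq_zero_of_mem_divergences {H : DDPoly Γ m β S} (hH : H ∈ divergences Γ m _)
    (b : β) : varDer H b = 0 := by
  let φ : DDPoly Γ m β S →+ DDPoly Γ m β S :=
    { toFun := fun H => varDer H b
      map_zero' := varDer_zero b
      map_add' := fun H F => varDer_add H F b }
  refine map_eq_zero_of_mem_divergences φ (fun l a => ?_) (fun g a => ?_) hH
  · change varDer (DDRing.der Γ l a) b = 0
    rw [varDer_eq, frechetDer_der, adjOne_derComp]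
  · change varDer (DDRing.shift m g a) b = varDer a b
    rw [varDer_eq, varDer_eq, frechetDer_shift, adjOne_shiftComp]

theorem varDer_C_mul_gen (a : S) (b c : β) [DecidableEq β] :
    varDer (C a * gen b : DDPoly Γ m β S) c = if b = c then C a else 0 := by
  rw [varDer_eq, Derivation.leibniz, frechetDer_C, smul_zero, add_zero, gen, frechetDer_X]
  by_cases h : b = c
  · rw [if_pos h, if_pos h, Finsupp.smul_single, adjOne_single, jetAdj_one_zero, smul_eq_mul,
      mul_one]
  · rw [if_neg h, if_neg h, smul_zero, map_zero]

/-- The pairing with a vector of independent variables is nondegenerate. -/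
theorem eq_zero_of_pairing_gen {n : ℕ} (a : Fin n → S)
    (h : pairing (fun i => C (a i)) (fun i => (gen i : DDPoly Γ m (Fin n) S)) ∈
      divergences Γ m _) : a = 0 := by
  ext i
  have := varDer_eq_zero_of_mem_divergences h i
  rw [varDer_eq, pairing, map_sum, map_sum] at this
  simp only [← varDer_eq, varDer_C_mul_gen, Finset.sum_ite_eq', Finset.mem_univ, if_true] at this
  exact C_injective _ _ (this.trans C_0.symm)

theorem map_varDer {T : Type*} [CommRing T] [DDRing Γ m T] (φ : S →+* T)
    (hφ : IsDDHom Γ m (φ : S →+ T)) (H : DDPoly Γ m β S) (b : β) :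
    MvPolynomial.map φ (varDer H b) = varDer (MvPolynomial.map φ H) b := by
  have hF : frechet b (MvPolynomial.map φ H) =
      (frechet b H).mapRange (MvPolynomial.map φ) (map_zero _) := by
    ext1 j
    rw [frechet_apply, Finsupp.mapRange_apply, frechet_apply, pderiv_map]
  rw [varDer, varDer, hF, DDOp.adj_eq, DDOp.adj_eq,
    Finsupp.sum_mapRange_index (by simp), Finsupp.sum, Finsupp.sum, map_sum]
  refine Finset.sum_congr rfl fun j _ => ?_
  rw [mul_one, mul_one]
  exact (isDDHom_map φ hφ).map_jetAdj _ _

end DDPoly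

/-! ### Change of coefficients and exchange of two sets of variables. -/

theorem isDDHom_algebraMap {Γ : Type v} [Group Γ] {m : ℕ} {R S : Type*} [CommRing R]
    [CommRing S] [Algebra R S] [DDRing Γ m R] [DDRing Γ m S] [DDExtension Γ m R S] :
    IsDDHom Γ m (algebraMap R S : R →+ S) where
  map_der l a := (DDExtension.der_algebraMap l a).symm
  map_shift g a := (DDExtension.shift_algebraMap g a).symm

instance DDExtension.instSelf {Γ : Type v} [Group Γ] {m : ℕ} {R : Type*} [CommRing R]
    [DDRing Γ m R] : DDExtension Γ m R R where
  injective := Function.injective_id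
  der_algebraMap _ _ := rfl
  shift_algebraMap _ _ := rfl

namespace DDPoly

variable {Γ : Type v} [Group Γ] {m : ℕ} {β : Type} {R : Type*} [CommRing R] [DDRing Γ m R]
  {S : Type*} [CommRing S] [DDRing Γ m S] [Algebra R S]

theorem isDDHom_CAlgHom :
    IsDDHom Γ m ((IsScalarTower.toAlgHom R S (DDPoly Γ m β S)) : S →+ DDPoly Γ m β S) :=
  ⟨isDDHom_C.map_der, isDDHom_C.map_shift⟩

theorem isDDHom_mapAlgHom [DDExtension Γ m R S] :
    IsDDHom Γ m ((mapAlgHom (Algebra.ofId R S) : DDPoly Γ m β R →ₐ[R] DDPoly Γ m β S) :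
      DDPoly Γ m β R →+ DDPoly Γ m β S) :=
  have h := isDDHom_map (β := β) (algebraMap R S) isDDHom_algebraMap
  ⟨h.map_der, h.map_shift⟩

/-- The structure operators have coefficients in R, so linearity over R is what `derivation_act` and
its analogues need. -/
theorem isDDHom_evolution_restrictScalars (K : β → DDPoly Γ m β S) :
    IsDDHom Γ m (((evolution K).restrictScalars R : Derivation R _ _) :
      DDPoly Γ m β S →+ DDPoly Γ m β S) :=
  ⟨(isDDHom_evolution K).map_der, (isDDHom_evolution K).map_shift⟩

variable (Γ m β R) in
/-- The homomorphism `R[y][q] → R[q][y]`. -/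
def swapHom (β' : Type) : DDPoly Γ m β (DDPoly Γ m β' R) →+* DDPoly Γ m β' (DDPoly Γ m β R) :=
  eval₂Hom (MvPolynomial.map C) fun q => C (X q)

/-- A divergence in R[y][q] thus becomes one in R[q][y], where δ/δy extracts coefficients lying in
R[q]. -/
theorem isDDHom_swapHom (β' : Type) :
    IsDDHom Γ m (swapHom Γ m β R β' : DDPoly Γ m β (DDPoly Γ m β' R) →+
      DDPoly Γ m β' (DDPoly Γ m β R)) := by
  have hC : (swapHom Γ m β R β').comp C = MvPolynomial.map C := by
    refine RingHom.ext fun a => ?_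
    simp [swapHom]
  refine isDDHom_of_gen _ ?_ fun b j => ?_
  · rw [hC]
    exact isDDHom_map C isDDHom_C
  · simp only [swapHom, gen, coe_eval₂Hom, eval₂_X]
    rw [← gen, ← jet_gen]
    exact isDDHom_C.map_jet j _

theorem swapHom_C_X (β' : Type) (q : β' × Γ × (Fin m → ℕ)) :
    swapHom Γ m β R β' (C (X q)) = X q := by
  simp [swapHom]

theorem swapHom_map (β' : Type) (a : DDPoly Γ m β R) :
    swapHom Γ m β R β' (MvPolynomial.map (algebraMap R (DDPoly Γ m β' R)) a) = C a := by
  induction a using MvPolynomial.induction_on with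
  | C a => simp [swapHom, MvPolynomial.algebraMap_eq]
  | add p q hp hq => rw [map_add, map_add, hp, hq, map_add]
  | mul_X p q hp =>
    rw [map_mul, map_mul, hp, map_X, map_mul]
    simp [swapHom]

end DDPoly

/-! ### The momentum map, its uniqueness and its equivariance. -/

namespace DDLieAlgebra.Rep

variable {Γ : Type v} [Group Γ] {m : ℕ} {R : Type u} [CommRing R] [DDRing Γ m R] {N M : ℕ}
  {𝔤 : DDLieAlgebra Γ m R N} (V : 𝔤.Rep M)

/-- The dual action is a representation. -/
theorem dualAct_bracket {S : Type (max u v)} [CommRing S] [Algebra R S] [DDRing Γ m S]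
    [DDExtension Γ m R S] (X Y : Fin N → S) (w : Fin M → S) :
    V.dualAct (𝔤.bracket X Y) w =
      V.dualAct X (V.dualAct Y w) - V.dualAct Y (V.dualAct X w) := by
  let ι := IsScalarTower.toAlgHom R S (DDPoly Γ m (Fin M) S)
  have hι : IsDDHom Γ m (ι : S →+ DDPoly Γ m (Fin M) S) := DDPoly.isDDHom_CAlgHom
  let c {n : ℕ} (X : Fin n → S) : Fin n → DDPoly Γ m (Fin M) S := fun i => ι (X i)
  have hdual (X : Fin N → S) (w : Fin M → S) : c (V.dualAct X w) = V.dualAct (c X) (c w) :=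
    funext fun k => V.algHom_dualAct hι X w k
  have hbr (X Y : Fin N → S) : c (𝔤.bracket X Y) = 𝔤.bracket (c X) (c Y) :=
    funext fun k => 𝔤.algHom_bracket hι X Y k
  -- X˙w is controlled only through pairings modulo divergences; a generic y makes these pairings
  -- separate vectors.
  let y : Fin M → DDPoly Γ m (Fin M) S := DDPoly.gen
  have dual (X : Fin N → S) (w : Fin M → S) (y : Fin M → DDPoly Γ m (Fin M) S) :
      DDEquiv Γ m (pairing (c (V.dualAct X w)) y) (- pairing (c w) (V.act (c X) y)) := by
    rw [hdual, ← neg_neg (pairing (V.dualAct (c X) (c w)) y)]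
    exact (V.pairing_act (c X) y (c w)).symm.neg
  have h1 := dual (𝔤.bracket X Y) w y
  rw [hbr, act_bracket, pairing_sub, neg_sub] at h1
  -- Two transposes reverse the order: ⟨X˙(Y˙w), y⟩ ∼ ⟨w, Y.(X.y)⟩. The reversal cancels the sign in
  -- the transpose of [X, Y].
  have h2 := ((dual X (V.dualAct Y w) y).trans (dual Y w (V.act (c X) y)).neg)
  have h3 := ((dual Y (V.dualAct X w) y).trans (dual X w (V.act (c Y) y)).neg)
  rw [neg_neg] at h2 h3
  have h4 := h1.trans (h2.sub h3).symm
  rw [← sub_eq_zero]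
  refine DDPoly.eq_zero_of_pairing_gen (Γ := Γ) (m := m) _ ?_
  rw [DDEquiv, ← sub_pairing, ← sub_pairing] at h4
  convert h4 using 2
  ext i
  simp only [Pi.sub_apply, c, map_sub]
  rfl

section Evolution

variable {S : Type*} [CommRing S] [Algebra R S] [DDRing Γ m S]

/-- The evolution derivation `W^∧`, where `W^∧(𝐱) = W.𝐱` and `W^∧(𝐩) = W˙𝐩`, for an element `W`
that may depend on `𝐱` and `𝐩`. -/
def fieldHat (W : Fin N → FunVV Γ m M S) : Derivation S (FunVV Γ m M S) (FunVV Γ m M S) :=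
  DDPoly.evolution (Sum.elim (V.act W (xvec Γ m M S)) (V.dualAct W (pvec Γ m M S)))

/-- The momentum map `H ↦ 𝐱 ∇ δH/δ𝐱 - δH/δ𝐩 ∇ 𝐩`. -/
def momentum (H : FunVV Γ m M S) : Fin N → FunVV Γ m M S :=
  V.nabla (xvec Γ m M S) (fun α => DDPoly.varDer H (Sum.inl α)) -
    V.nabla (fun α => DDPoly.varDer H (Sum.inr α)) (pvec Γ m M S)

theorem isDDHom_hat (X : Fin N → S) :
    IsDDHom Γ m (V.hat X : FunVV Γ m M S →+ FunVV Γ m M S) := DDPoly.isDDHom_evolution _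

theorem hat_C (X : Fin N → S) (a : S) : V.hat X (C a) = 0 := DDPoly.evolution_C _ _

/-- Integration by parts gives ⟨δF/δ𝐱, W.𝐱⟩ + ⟨δF/δ𝐩, W˙𝐩⟩, and ∇ isolates W in each term. -/
theorem fieldHat_ddEquiv (W : Fin N → FunVV Γ m M S) (F : FunVV Γ m M S) :
    DDEquiv Γ m (V.fieldHat W F) (pairing (V.momentum F) W) := by
  refine (DDPoly.evolution_ddEquiv _ F).trans ?_
  rw [Fintype.sum_sum_type, momentum, sub_pairing, sub_eq_add_neg]
  exact (V.pairing_act_nabla W (xvec Γ m M S) fun α => DDPoly.varDer F (Sum.inl α)).add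
    (V.pairing_dualAct_nabla W (fun α => DDPoly.varDer F (Sum.inr α)) (pvec Γ m M S))

/-- On 𝐱: X^∧(W.𝐱) = X^∧(W).𝐱 + W.(X.𝐱), while W^∧(X.𝐱) = X.(W.𝐱) because X is constant. The
difference is (X^∧(W) + [W, X]).𝐱, and likewise on 𝐩. Assuming the two representation identities
leaves the universe of `S` free. -/
theorem hat_fieldHat_commutator
    (hact : ∀ (X Y : Fin N → FunVV Γ m M S) (w : Fin M → FunVV Γ m M S),
      V.act (𝔤.bracket X Y) w = V.act X (V.act Y w) - V.act Y (V.act X w))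
    (hdual : ∀ (X Y : Fin N → FunVV Γ m M S) (w : Fin M → FunVV Γ m M S),
      V.dualAct (𝔤.bracket X Y) w = V.dualAct X (V.dualAct Y w) - V.dualAct Y (V.dualAct X w))
    (X : Fin N → S) (W : Fin N → FunVV Γ m M S) (H : FunVV Γ m M S) :
    V.hat X (V.fieldHat W H) - V.fieldHat W (V.hat X H) =
      V.fieldHat ((fun i => V.hat X (W i)) + 𝔤.bracket W fun i => C (X i)) H := by
  set c : Fin N → FunVV Γ m M S := fun i => C (X i) with hc
  set K := Sum.elim (V.act c (xvec Γ m M S)) (V.dualAct c (pvec Γ m M S)) with hK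
  set L := Sum.elim (V.act W (xvec Γ m M S)) (V.dualAct W (pvec Γ m M S)) with hL
  have hKd := DDPoly.isDDHom_evolution_restrictScalars (R := R) K
  have hLd := DDPoly.isDDHom_evolution_restrictScalars (R := R) L
  have hc0 : (fun i => DDPoly.evolution L (c i)) = 0 :=
    funext fun i => DDPoly.evolution_C L (X i)
  have gen_inl (J : Fin M ⊕ Fin M → FunVV Γ m M S) :
      (fun α => DDPoly.evolution J (xvec Γ m M S α)) = fun α => J (Sum.inl α) :=
    funext fun α => DDPoly.evolution_gen J _
  have gen_inr (J : Fin M ⊕ Fin M → FunVV Γ m M S) :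
      (fun α => DDPoly.evolution J (pvec Γ m M S α)) = fun α => J (Sum.inr α) :=
    funext fun α => DDPoly.evolution_gen J _
  refine DDPoly.evolution_commutator K L _ (fun b => ?_) H
  cases b with
  | inl α =>
    have h1 := V.derivation_act hKd W (xvec Γ m M S) α
    have h2 := V.derivation_act hLd c (xvec Γ m M S) α
    simp only [Derivation.restrictScalars_apply, gen_inl, hc0, zero_act] at h1 h2
    change DDPoly.evolution K (V.act W (xvec Γ m M S) α) -
      DDPoly.evolution L (V.act c (xvec Γ m M S) α) = V.act _ _ α
    rw [h1, h2, add_act, hact]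
    change _ + V.act W (V.act c (xvec Γ m M S)) α -
      (_ + V.act c (V.act W (xvec Γ m M S)) α) = V.act (fun i => DDPoly.evolution K (W i)) _ α + _
    simp only [Pi.zero_apply, Pi.sub_apply]
    ring
  | inr α =>
    have h1 := V.derivation_dualAct hKd W (pvec Γ m M S) α
    have h2 := V.derivation_dualAct hLd c (pvec Γ m M S) α
    simp only [Derivation.restrictScalars_apply, gen_inr, hc0, zero_dualAct] at h1 h2
    change DDPoly.evolution K (V.dualAct W (pvec Γ m M S) α) -
      DDPoly.evolution L (V.dualAct c (pvec Γ m M S) α) = V.dualAct _ _ α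
    rw [h1, h2, add_dualAct, hdual]
    change _ + V.dualAct W (V.dualAct c (pvec Γ m M S)) α -
      (_ + V.dualAct c (V.dualAct W (pvec Γ m M S)) α) =
        V.dualAct (fun i => DDPoly.evolution K (W i)) _ α + _
    simp only [Pi.zero_apply, Pi.sub_apply]
    ring

/-- The case of constant W, where Y^∧(W) = 0. -/
theorem hat_hat_of
    (hact : ∀ (X Y : Fin N → FunVV Γ m M S) (w : Fin M → FunVV Γ m M S),
      V.act (𝔤.bracket X Y) w = V.act X (V.act Y w) - V.act Y (V.act X w))
    (hdual : ∀ (X Y : Fin N → FunVV Γ m M S) (w : Fin M → FunVV Γ m M S),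
      V.dualAct (𝔤.bracket X Y) w = V.dualAct X (V.dualAct Y w) - V.dualAct Y (V.dualAct X w))
    (X Y : Fin N → S) (H : FunVV Γ m M S) :
    V.hat Y (V.hat X H) = V.hat X (V.hat Y H) +
      V.fieldHat (𝔤.bracket (fun i => C (X i)) fun i => C (Y i)) H := by
  have := V.hat_fieldHat_commutator hact hdual Y (fun i => C (X i)) H
  simp only [hat_C] at this
  rw [← sub_eq_iff_eq_add']
  refine this.trans ?_
  congr 2
  exact zero_add _

variable [DDExtension Γ m R S]

theorem map_momentum (H : FunVV Γ m M R) (i : Fin N) :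
    MvPolynomial.map (algebraMap R S) (V.momentum H i) =
      V.momentum (MvPolynomial.map (algebraMap R S) H) i := by
  have h := DDPoly.isDDHom_mapAlgHom (Γ := Γ) (m := m) (β := Fin M ⊕ Fin M) (R := R) (S := S)
  have hv (b : Fin M ⊕ Fin M) := DDPoly.map_varDer (Γ := Γ) (m := m) (algebraMap R S)
    isDDHom_algebraMap H b
  have h1 := V.algHom_nabla h (xvec Γ m M R) (fun α => DDPoly.varDer H (Sum.inl α)) i
  have h2 := V.algHom_nabla h (fun α => DDPoly.varDer H (Sum.inr α)) (pvec Γ m M R) i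
  change MvPolynomial.map (algebraMap R S) _ = V.nabla
    (fun α => MvPolynomial.map (algebraMap R S) (xvec Γ m M R α))
    (fun α => MvPolynomial.map (algebraMap R S) (DDPoly.varDer H (Sum.inl α))) i at h1
  change MvPolynomial.map (algebraMap R S) _ = V.nabla
    (fun α => MvPolynomial.map (algebraMap R S) (DDPoly.varDer H (Sum.inr α)))
    (fun α => MvPolynomial.map (algebraMap R S) (pvec Γ m M R α)) i at h2
  simp only [hv, xvec, pvec, DDPoly.gen, map_X] at h1 h2
  simp only [momentum, Pi.sub_apply, map_sub]
  exact congrArg₂ (· - ·) h1 h2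

theorem map_hat (X : Fin N → R) (H : FunVV Γ m M R) :
    MvPolynomial.map (algebraMap R S) (V.hat X H) =
      V.hat (fun i => algebraMap R S (X i)) (MvPolynomial.map (algebraMap R S) H) := by
  have h := DDPoly.isDDHom_mapAlgHom (Γ := Γ) (m := m) (β := Fin M ⊕ Fin M) (R := R) (S := S)
  refine (DDPoly.map_evolution (algebraMap R S) isDDHom_algebraMap _ H).trans ?_
  rw [hat]
  congr 2
  ext1 b
  cases b with
  | inl α =>
    refine (V.algHom_act h _ _ α).trans ?_
    simp [xvec, DDPoly.gen]
    rfl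
  | inr α =>
    refine (V.algHom_dualAct h _ _ α).trans ?_
    simp [pvec, DDPoly.gen]
    rfl

end Evolution

theorem isTilde_momentum (H : FunVV Γ m M R) : V.IsTilde H (V.momentum H) := by
  intro S _ _ _ _ X
  simp only [map_momentum]
  exact (V.fieldHat_ddEquiv (fun i => C (X i)) _).symm

/-- The defining relation is tested on one generic X, a vector of independent variables adjoined to
R. -/
theorem IsTilde.unique {H : FunVV Γ m M R} {a b : Fin N → FunVV Γ m M R} (ha : V.IsTilde H a)
    (hb : V.IsTilde H b) : a = b := by
  let y : Fin N → DDPoly Γ m (Fin N) R := DDPoly.gen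
  have h := (ha (DDPoly Γ m (Fin N) R) y).trans (hb (DDPoly Γ m (Fin N) R) y).symm
  have h' := (DDPoly.isDDHom_swapHom (β := Fin M ⊕ Fin M) (Fin N)).map_ddEquiv h
  rw [← sub_eq_zero]
  refine DDPoly.eq_zero_of_pairing_gen (Γ := Γ) (m := m) _ ?_
  have hs (a : Fin N → FunVV Γ m M R) : DDPoly.swapHom Γ m (Fin M ⊕ Fin M) R (Fin N)
      (pairing (fun i => MvPolynomial.map (algebraMap R (DDPoly Γ m (Fin N) R)) (a i))
        fun i => C (y i)) = pairing (fun i => C (a i)) (fun i => DDPoly.gen i) := by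
    simp only [pairing, map_sum, map_mul, DDPoly.swapHom_map, y, DDPoly.gen, DDPoly.swapHom_C_X]
  change DDEquiv Γ m (DDPoly.swapHom Γ m (Fin M ⊕ Fin M) R (Fin N) _)
    (DDPoly.swapHom Γ m (Fin M ⊕ Fin M) R (Fin N) _) at h'
  rw [hs, hs, DDEquiv, ← sub_pairing] at h'
  convert h' using 2
  ext1 i
  simp

/-- The momentum map is equivariant. -/
theorem momentum_hat (X : Fin N → R) (H : FunVV Γ m M R) :
    V.momentum (V.hat X H) =
      (fun i => V.hat X (V.momentum H i)) - 𝔤.coad (fun i => C (X i)) (V.momentum H) := by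
  -- By uniqueness it is enough that the right-hand side satisfies the defining relation of (X^∧
  -- H)^∼.
  refine (V.isTilde_momentum _).unique V ?_
  intro S _ _ _ _ Y
  set H' := MvPolynomial.map (algebraMap R S) H with hH'
  set X' : Fin N → S := fun i => algebraMap R S (X i) with hX'
  have hd := DDPoly.isDDHom_mapAlgHom (Γ := Γ) (m := m) (β := Fin M ⊕ Fin M) (R := R) (S := S)
  have hmap : (fun i => MvPolynomial.map (algebraMap R S)
      (((fun i => V.hat X (V.momentum H i)) - 𝔤.coad (fun i => C (X i)) (V.momentum H)) i)) =
      (fun i => V.hat X' (V.momentum H' i)) - 𝔤.coad (fun i => C (X' i)) (V.momentum H') := by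
    ext1 i
    have h1 := 𝔤.algHom_coad hd (fun i => C (X i)) (V.momentum H) i
    change MvPolynomial.map (algebraMap R S) _ = 𝔤.coad
      (fun i => MvPolynomial.map (algebraMap R S) (C (X i)))
      (fun i => MvPolynomial.map (algebraMap R S) (V.momentum H i)) i at h1
    simp only [map_C, map_momentum] at h1
    simp only [Pi.sub_apply, map_sub, h1, map_hat, map_momentum]
    rfl
  -- Y^∧X^∧H = X^∧Y^∧H + [X, Y]^∧H. As Y is constant, the first summand gives ⟨X^∧(J(H)), Y⟩; the
  -- second gives ⟨J(H), [X, Y]⟩ ∼ −⟨X˙J(H), Y⟩.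
  rw [hmap, map_hat, V.hat_hat_of V.act_bracket V.dualAct_bracket, sub_pairing, sub_eq_add_neg]
  refine DDEquiv.add ?_ ?_
  · have h1 := (V.isDDHom_hat X').map_ddEquiv
      (V.fieldHat_ddEquiv (fun i => C (Y i)) H').symm
    refine DDEquiv.trans (DDEquiv.of_eq ?_) h1
    change _ = V.hat X' (pairing _ _)
    simp only [pairing, map_sum, Derivation.leibniz, hat_C, smul_eq_mul,
      mul_comm, zero_mul, add_zero]
  · exact ((V.fieldHat_ddEquiv _ H').trans (𝔤.pairing_bracket _ _ _)).symm

end DDLieAlgebra.Rep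

/-! ### The quadratic bracket and the Hamiltonian action criterion. -/

namespace DDLieAlgebra

variable {Γ : Type v} [Group Γ] {m : ℕ} {R : Type u} [CommRing R] [DDRing Γ m R] {N M : ℕ}
  {𝔤 : DDLieAlgebra Γ m R N} (V : 𝔤.Rep M) (O : 𝔤.OOperator)

theorem neg_bracket {S : Type*} [CommRing S] [Algebra R S] [DDRing Γ m S] (X Y : Fin N → S) :
    𝔤.bracket (-X) Y = - 𝔤.bracket X Y := by
  have h : 𝔤.bracket (-X) Y + 𝔤.bracket X Y = 𝔤.bracket (-X + X) Y := by
    ext k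
    simp only [bracket, Pi.add_apply, DDBiOp.apply_add_left, Finset.sum_add_distrib]
  rw [neg_add_cancel] at h
  rw [eq_neg_iff_add_eq_zero, h]
  ext k
  simp [bracket, DDBiOp.apply_zero_left]

namespace Rep

/-- ⟨Y, W.𝐱⟩ ∼ ⟨𝐱 ∇ Y, W⟩, and skewness of 𝒪 absorbs the minus sign in W. Setting K or L to zero
yields the separate blocks. -/
theorem pairing_quadMatrix_inl (K L : Fin M → FunVV Γ m M R) (Y : Fin M → FunVV Γ m M R) :
    DDEquiv Γ m (pairing Y fun α => V.quadMatrix O (Sum.elim K L) (Sum.inl α))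
      (pairing (V.nabla (xvec Γ m M R) K - V.nabla L (pvec Γ m M R))
        (O.apply (V.nabla (xvec Γ m M R) Y))) := by
  refine (V.pairing_act_nabla _ _ _).trans ?_
  rw [pairing_neg]
  refine (O.pairing_apply _ _).neg.trans (DDEquiv.of_eq ?_)
  rw [neg_neg]
  rfl

theorem pairing_quadMatrix_inr (K L : Fin M → FunVV Γ m M R) (Y : Fin M → FunVV Γ m M R) :
    DDEquiv Γ m (pairing Y fun α => V.quadMatrix O (Sum.elim K L) (Sum.inr α))
      (- pairing (V.nabla (xvec Γ m M R) K - V.nabla L (pvec Γ m M R))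
        (O.apply (V.nabla Y (pvec Γ m M R)))) := by
  refine (V.pairing_dualAct_nabla _ _ _).trans ?_
  rw [pairing_neg, neg_neg]
  exact O.pairing_apply _ _

theorem quadBracket_eq (H F : FunVV Γ m M R) :
    V.quadBracket O H F = V.fieldHat (-O.apply (V.momentum H)) F := rfl

/-- The quadratic bracket satisfies the infinitesimal Hamiltonian action criterion. -/
theorem hat_quadBracket_ddEquiv (H F : FunVV Γ m M R) (X : Fin N → R) :
    DDEquiv Γ m
      (V.hat X (V.quadBracket O H F) - V.quadBracket O (V.hat X H) F
        - V.quadBracket O H (V.hat X F))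
      (pairing (O.dualBracket (V.momentum H) (V.momentum F)) fun i => C (X i)) := by
  simp only [quadBracket_eq, V.momentum_hat]
  set h := V.momentum H
  set c : Fin N → FunVV Γ m M R := fun i => C (X i)
  set Dh : Fin N → FunVV Γ m M R := fun i => V.hat X (h i)
  have hD : (fun i => V.hat X ((-O.apply h) i)) = - O.apply Dh := by
    ext1 i
    have := O.derivation_apply (DDPoly.isDDHom_evolution_restrictScalars (R := R)
      (Sum.elim (V.act c (xvec Γ m M R)) (V.dualAct c (pvec Γ m M R)))) h i
    rw [Pi.neg_apply, map_neg]
    exact congrArg Neg.neg this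
  -- Regrouping pairs X^∧{H, F} with {H, X^∧F}: their difference is the commutator of X^∧ and W^∧
  -- applied to F, with W = −𝒪(h).
  rw [sub_right_comm, V.hat_fieldHat_commutator V.act_bracket V.dualAct_bracket, hD]
  refine ((V.fieldHat_ddEquiv _ F).sub (V.fieldHat_ddEquiv _ F)).trans ?_
  set f := V.momentum F
  have e1 : pairing f (-O.apply Dh + 𝔤.bracket (-O.apply h) c) -
      pairing f (-O.apply (Dh - 𝔤.coad c h)) =
      - pairing f (𝔤.bracket (O.apply h) c) - pairing f (O.apply (𝔤.coad c h)) := by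
    simp only [neg_bracket, O.apply_sub, pairing_add, pairing_neg, pairing_sub]
    ring
  have h1 := (𝔤.pairing_bracket (O.apply h) c f).neg
  -- ⟨f, 𝒪(X˙h)⟩ ∼ −⟨X˙h, 𝒪(f)⟩ ∼ ⟨h, [X, 𝒪(f)]⟩ = −⟨h, [𝒪(f), X]⟩ ∼ ⟨𝒪(f)˙h, X⟩.
  have h2 : DDEquiv Γ m (pairing f (O.apply (𝔤.coad c h)))
      (pairing (𝔤.coad (O.apply f) h) c) := by
    refine (O.pairing_apply _ _).trans ((𝔤.pairing_bracket _ _ _).symm.trans ?_)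
    rw [𝔤.bracket_skew, pairing_neg, ← neg_neg (pairing (𝔤.coad (O.apply f) h) c)]
    exact (𝔤.pairing_bracket _ _ _).neg
  rw [e1, OOperator.dualBracket, sub_pairing, ← neg_neg (pairing (𝔤.coad (O.apply h) f) c)]
  exact h1.sub h2

end Rep

end DDLieAlgebra

end

/-! ### Assembly of the four statements. -/

theorem proposition9p27 {Γ : Type v} [Group Γ] {m : ℕ} {R : Type u} [CommRing R] [DDRing Γ m R]
    {N M : ℕ} (𝔤 : DDLieAlgebra Γ m R N) (V : 𝔤.Rep M) (O : 𝔤.OOperator) :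
    -- the four defining relations of the quadratic Hamiltonian matrix
    (∀ K L : Fin M → FunVV Γ m M R,
      DDEquiv Γ m (pairing L fun α => V.quadMatrix O (Sum.elim K 0) (Sum.inl α))
        (pairing (V.nabla (xvec Γ m M R) K) (O.apply (V.nabla (xvec Γ m M R) L))) ∧
      DDEquiv Γ m (pairing L fun α => V.quadMatrix O (Sum.elim 0 K) (Sum.inl α))
        (- pairing (V.nabla K (pvec Γ m M R)) (O.apply (V.nabla (xvec Γ m M R) L))) ∧
      DDEquiv Γ m (pairing L fun α => V.quadMatrix O (Sum.elim K 0) (Sum.inr α))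
        (- pairing (V.nabla (xvec Γ m M R) K) (O.apply (V.nabla L (pvec Γ m M R)))) ∧
      DDEquiv Γ m (pairing L fun α => V.quadMatrix O (Sum.elim 0 K) (Sum.inr α))
        (pairing (V.nabla K (pvec Γ m M R)) (O.apply (V.nabla L (pvec Γ m M R))))) ∧
    -- `X ↦ X^∧` is an antirepresentation
    (∀ (X Y : Fin N → R) (H : FunVV Γ m M R),
      V.hat (𝔤.bracket X Y) H = V.hat Y (V.hat X H) - V.hat X (V.hat Y H)) ∧
    -- `H^∼` is well defined
    (∀ H : FunVV Γ m M R, ∃! a, V.IsTilde H a) ∧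
    -- the criterion of infinitesimal Hamiltonian action
    (∀ (H F : FunVV Γ m M R) (a b : Fin N → FunVV Γ m M R),
      V.IsTilde H a → V.IsTilde F b → ∀ X : Fin N → R,
        DDEquiv Γ m
          (V.hat X (V.quadBracket O H F) - V.quadBracket O (V.hat X H) F
            - V.quadBracket O H (V.hat X F))
          (pairing (O.dualBracket a b) fun i => C (X i))) := by
  refine ⟨fun K L => ⟨?_, ?_, ?_, ?_⟩, fun X Y H => ?_, fun H => ?_, fun H F a b ha hb X => ?_⟩
  · simpa only [V.zero_nabla, sub_zero] using V.pairing_quadMatrix_inl O K 0 L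
  · simpa only [V.nabla_zero, zero_sub, neg_pairing] using V.pairing_quadMatrix_inl O 0 K L
  · simpa only [V.zero_nabla, sub_zero] using V.pairing_quadMatrix_inr O K 0 L
  · simpa only [V.nabla_zero, zero_sub, neg_pairing, neg_neg] using
      V.pairing_quadMatrix_inr O 0 K L
  · have hbr : (fun i => C (𝔤.bracket X Y i)) =
        𝔤.bracket (fun i => (C (X i) : FunVV Γ m M R)) fun i => C (Y i) :=
      funext (𝔤.algHom_bracket DDPoly.isDDHom_CAlgHom X Y)
    rw [V.hat_hat_of V.act_bracket V.dualAct_bracket, add_sub_cancel_left, ← hbr]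
    rfl
  · exact ⟨V.momentum H, V.isTilde_momentum H, fun b hb => hb.unique V (V.isTilde_momentum H)⟩
  -- Uniqueness replaces the given H^∼ and F^∼ by the momentum maps.
  · obtain rfl := ha.unique V (V.isTilde_momentum H)
    obtain rfl := hb.unique V (V.isTilde_momentum F)
    exact V.hat_quadBracket_ddEquiv O H F X
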